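/- Conventions. Let $\|\cdot\|_{q,I}$ ($0<q\le\infty$) be the usual (quasi-)norm of $L_q(I)$ for an interval $I\subset(0,\infty)$, with $1/\infty=0$. A positive Lebesgue measurable function $b$ on $(0,\infty)$ is slowly varying ($b\in SV$) if for every $\varepsilon>0$ the function $t^{\varepsilon}b(t)$ is equivalent to an increasing function and $t^{-\varepsilon}b(t)$ is equivalent to a decreasing function. For a compatible couple $\bar A=(A_0,A_1)$ of (real or complex) quasi-Banach spaces, i.e. two quasi-Banach spaces continuously embedded in a common Hausdorff topological vector space, put $K(t,f;A_0,A_1)=\inf\{\|f_0\|_{A_0}+t\|f_1\|_{A_1} : f=f_0+f_1,\ f_i\in A_i\}$ and $K(t,f)=K(t,f;A_0,A_1)$. For $0\le\theta\le1$, $0<r,q\le\infty$, $a,b\in SV$, let $\bar A^{\mathcal L}_{\theta,r,b,q,a}$ be the space of all $f\in A_0+A_1$ such that $$\|f\|=\Big\|t^{-1/r}b(t)\,\big\|u^{-\theta-1/q}a(u)K(u,f)\big\|_{q,(0,t)}\Big\|_{r,(0,\infty)}<\infty .$$ Theorem. Let $0<r_0,q_0,r_1,q_1\le\infty$ and $a_0,b_0,a_1,b_1\in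 SV$ satisfy $$\Big\|s^{-1/r_0}b_0(s)\big\|u^{-1/q_0}a_0(u)\big\|_{q_0,(1,s)}\Big\|_{r_0,(1,\infty)}<\infty,\quad \big\|s^{-1/r_1}b_1(s)\big\|_{r_1,(1,\infty)}<\infty,\quad \Big\|s^{-1/r_1}b_1(s)\big\|u^{-1/q_1}a_1(u)\big\|_{q_1,(0,s)}\Big\|_{r_1,(0,1)}<\infty .$$ For $t>0$ put $$\chi_0(t)=\Big\|s^{-1/r_0}b_0(s)\big\|u^{-1/q_0}a_0(u)\big\|_{q_0,(t,s)}\Big\|_{r_0,(t,\infty)},$$ $$\chi_1(t)=\Big\|s^{-1/r_1}b_1(s)\big\|u^{-1/q_1}a_1(u)\big\|_{q_1,(0,s)}\Big\|_{r_1,(0,t)}+\big\|s^{-1/r_1}b_1(s)\big\|_{r_1,(t,\infty)}\big\|u^{-1/q_1}a_1(u)\big\|_{q_1,(0,t)} .$$ Then $0<\chi_0(t),\chi_1(t)<\infty$ for all $t>0$; put $\rho(t)=t\,\chi_0(t)/\chi_1(t)$. Moreover, for every compatible couple $(A_0,A_1)$ of quasi-Banach spaces with $A_0\cap A_1\ne\{0\}$,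 all $f\in\bar A^{\mathcal L}_{0,r_0,b_0,q_0,a_0}+\bar A^{\mathcal L}_{1,r_1,b_1,q_1,a_1}$ and all $t>0$, $$\begin{aligned}K\big(\rho(t),f;\bar A^{\mathcal L}_{0,r_0,b_0,q_0,a_0},\bar A^{\mathcal L}_{1,r_1,b_1,q_1,a_1}\big)\approx{}&\Big\|s^{-1/r_0}b_0(s)\big\|u^{-1/q_0}a_0(u)K(u,f)\big\|_{q_0,(0,s)}\Big\|_{r_0,(0,t)}\\&+\big\|s^{-1/r_0}b_0(s)\big\|_{r_0,(t,\infty)}\big\|u^{-1/q_0}a_0(u)K(u,f)\big\|_{q_0,(0,t)}\\&+\rho(t)\Big\|s^{-1/r_1}b_1(s)\big\|u^{-1-1/q_1}a_1(u)K(u,f)\big\|_{q_1,(t,s)}\Big\|_{r_1,(t,\infty)}+\chi_0(t)K(t,f).\end{aligned}$$ Here $X\approx Y$ means $X\le CY$ and $Y\le CX$ with a constant $C$ independent of $f$, of $t$ and of the couple, depending only on the parameters $r_i,q_i,a_i,b_i$ ($i=0,1$) and on a bound for the constants in the quasi-triangle inequalities of $A_0$ and $A_1$. -/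

import Mathlib

open Set Filter Topology MeasureTheory
open scoped NNReal ENNReal

universe u

noncomputable section

namespace LimitingInterpolation

/-- `f` is equivalent on `(0, ∞)` to the function `g`: each is bounded by a constant times the
other. -/
def EquivOnPos (f g : ℝ → ℝ) : Prop :=
  ∃ c : ℝ, 0 < c ∧ ∀ t : ℝ, 0 < t → f t ≤ c * g t ∧ g t ≤ c * f t

/-- Slowly varying functions on `(0, ∞)`: positive Lebesgue measurable functions `b` such that, for
each `ε > 0`, `t ^ ε * b t` is equivalent to an increasing function and `t ^ (-ε) * b t` is
equivalent to a decreasing function. Values outside `(0, ∞)` are irrelevant. -/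
structure IsSlowlyVarying (b : ℝ → ℝ) : Prop where
  pos : ∀ t : ℝ, 0 < t → 0 < b t
  measurable : AEMeasurable b (volume.restrict (Ioi 0))
  equiv_increasing : ∀ ε : ℝ, 0 < ε →
    ∃ g : ℝ → ℝ, MonotoneOn g (Ioi 0) ∧ EquivOnPos (fun t => t ^ ε * b t) g
  equiv_decreasing : ∀ ε : ℝ, 0 < ε →
    ∃ g : ℝ → ℝ, AntitoneOn g (Ioi 0) ∧ EquivOnPos (fun t => t ^ (-ε) * b t) g

/-- The weighted Lebesgue (quasi-)norm `‖u ^ (α - 1/q) a(u) F(u)‖_{q, I}` of a function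
`F ≥ 0` over a set `I ⊆ (0, ∞)`, where `0 < q ≤ ∞` and `1/∞ = 0`. -/
def wNorm (α : ℝ) (q : ℝ≥0∞) (a : ℝ → ℝ) (I : Set ℝ) (F : ℝ → ℝ≥0∞) : ℝ≥0∞ :=
  eLpNorm (fun x : ℝ => ENNReal.ofReal (x ^ (α - (q⁻¹).toReal) * a x) * F x) q
    (volume.restrict I)

/-- `N` is the quasi-norm, extended by the value `∞` off the space, of a quasi-Banach space
`{x | N x < ∞}` over `𝕜` which is continuously embedded in the topological vector space `E`;
`κ` is a constant in its quasi-triangle inequality. -/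
structure IsQuasiBanachIn (𝕜 : Type*) [RCLike 𝕜] {E : Type*} [AddCommGroup E] [Module 𝕜 E]
    [TopologicalSpace E] (κ : ℝ≥0) (N : E → ℝ≥0∞) : Prop where
  eq_zero_of : ∀ x : E, N x = 0 → x = 0
  smul : ∀ (c : 𝕜) (x : E), N (c • x) = ‖c‖ₑ * N x
  add_le : ∀ x y : E, N (x + y) ≤ κ * (N x + N y)
  embedding : ∀ U ∈ 𝓝 (0 : E), ∃ ε : ℝ≥0∞, 0 < ε ∧ ∀ x : E, N x < ε → x ∈ U
  complete : ∀ x : ℕ → E, (∀ n, N (x n) < ∞) →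
    (∀ ε : ℝ≥0∞, 0 < ε → ∃ n₀, ∀ m ≥ n₀, ∀ n ≥ n₀, N (x m - x n) < ε) →
    ∃ y : E, N y < ∞ ∧ Tendsto (fun n => N (x n - y)) atTop (𝓝 0)

/-- Peetre's `K`-functional `K(t, f; A₀, A₁)`, the infimum of `‖f₀‖_{A₀} + t ‖f₁‖_{A₁}` over
`f = f₀ + f₁`, for two spaces given by their (extended) quasi-norms `N₀`, `N₁`. For `t > 0`,
decompositions with `f₀ ∉ A₀` or `f₁ ∉ A₁` contribute the value `∞`. -/
def KFunctional {E : Type*} [AddCommGroup E] (N₀ N₁ : E → ℝ≥0∞) (t : ℝ) (f : E) : ℝ≥0∞ :=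
  ⨅ (f₀ : E) (f₁ : E) (_ : f = f₀ + f₁), N₀ f₀ + ENNReal.ofReal t * N₁ f₁

/-- The elements of the sum `A₀ + A₁`. -/
def MemSum {E : Type*} [AddCommGroup E] (N₀ N₁ : E → ℝ≥0∞) (f : E) : Prop :=
  ∃ f₀ f₁ : E, f = f₀ + f₁ ∧ N₀ f₀ < ∞ ∧ N₁ f₁ < ∞

open Classical in
/-- The (extended) quasi-norm of the limiting space `(A₀, A₁)^L_{θ, r, b, q, a}`, which consists of
the `f ∈ A₀ + A₁` for which
`‖t ^ (-1/r) b(t) ‖u ^ (-θ-1/q) a(u) K(u, f)‖_{q, (0, t)}‖_{r, (0, ∞)}` is finite. -/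
def limLNorm {E : Type*} [AddCommGroup E] (N₀ N₁ : E → ℝ≥0∞) (θ : ℝ) (r : ℝ≥0∞) (b : ℝ → ℝ)
    (q : ℝ≥0∞) (a : ℝ → ℝ) (f : E) : ℝ≥0∞ :=
  if MemSum N₀ N₁ f then
    wNorm 0 r b (Ioi 0) fun t => wNorm (-θ) q a (Ioo 0 t) fun x => KFunctional N₀ N₁ x f
  else ∞

/-- `χ₀(t) = ‖s ^ (-1/r₀) b₀(s) ‖u ^ (-1/q₀) a₀(u)‖_{q₀, (t, s)}‖_{r₀, (t, ∞)}`. -/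
def chi0 (r₀ : ℝ≥0∞) (b₀ : ℝ → ℝ) (q₀ : ℝ≥0∞) (a₀ : ℝ → ℝ) (t : ℝ) : ℝ≥0∞ :=
  wNorm 0 r₀ b₀ (Ioi t) fun s => wNorm 0 q₀ a₀ (Ioo t s) fun _ => 1

/-- `χ₁(t) = ‖s ^ (-1/r₁) b₁(s) ‖u ^ (-1/q₁) a₁(u)‖_{q₁, (0, s)}‖_{r₁, (0, t)}
  + ‖s ^ (-1/r₁) b₁(s)‖_{r₁, (t, ∞)} ‖u ^ (-1/q₁) a₁(u)‖_{q₁, (0, t)}`. -/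
def chi1 (r₁ : ℝ≥0∞) (b₁ : ℝ → ℝ) (q₁ : ℝ≥0∞) (a₁ : ℝ → ℝ) (t : ℝ) : ℝ≥0∞ :=
  (wNorm 0 r₁ b₁ (Ioo 0 t) fun s => wNorm 0 q₁ a₁ (Ioo 0 s) fun _ => 1)
    + (wNorm 0 r₁ b₁ (Ioi t) fun _ => 1) * (wNorm 0 q₁ a₁ (Ioo 0 t) fun _ => 1)

/-- `ρ(t) = t χ₀(t) / χ₁(t)`. -/
def rho (r₀ : ℝ≥0∞) (b₀ : ℝ → ℝ) (q₀ : ℝ≥0∞) (a₀ : ℝ → ℝ) (r₁ : ℝ≥0∞) (b₁ : ℝ → ℝ) (q₁ : ℝ≥0∞)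
    (a₁ : ℝ → ℝ) (t : ℝ) : ℝ :=
  t * (chi0 r₀ b₀ q₀ a₀ t).toReal / (chi1 r₁ b₁ q₁ a₁ t).toReal

end LimitingInterpolation

end

/-!
The formula is a Holmstedt-type reiteration formula, and both inequalities are reduced to
properties of the function `F = K(·, f)`: it is increasing, and `F(t) / t` is decreasing
(`QuasiConcave`).

Besides positivity and measurability, the only property of slowly varying functions that enters is
Potter's bound `a x ≤ C max (x/y) (y/x) ^ ε a y` (`IsSlowlyVarying.exists_le_rpow_mul`). Through
the substitution `x ↦ l x` it yields that `χ₀` and `χ₁` change by at most a factor `C max (u/t)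
(t/u) ^ (1/2)` between `u` and `t` (`exists_powerBounded_chi0`, `exists_powerBounded_chi1`). Hence
their finiteness at one point gives it everywhere, and their reciprocals can be pulled out of
weighted norms that carry a power of exponent `±1` (`PowerBounded.exists_wNorm_Ioo_le_left`,
`PowerBounded.exists_wNorm_Ioo_le_right`).

For the upper estimate of the `K`-functional (`exists_KFunctional_limLNorm_le`), take an almost
optimal decomposition `f = f₀ + f₁` for `K(t, f)`. Then `K(u, f₀)` is bounded by multiples of `K(u,
f)` for `u < t` and of `K(t, f)` for `u > t`, while `K(u, f₁)` is bounded by multiples of `(u/t)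
K(t, f)` for `u < t` and of `K(u, f)` for `u > t`. Splitting the norms of the two spaces at `t`
(`exists_nestedNorm_le`) produces exactly the four terms on the right-hand side. If `K(t, f) = 0`,
an almost optimal decomposition exists only because then `f = 0`, which is where the Hausdorff
property of the ambient space is used.

For the lower estimate (`exists_holmstedtSum_le_KFunctional`), the right-hand side is
quasi-subadditive in `f`, so it suffices to bound it on each of the two spaces. On the first one,
`χ₀(u) K(u, g) ≤ ‖g‖` controls the term with the norm of the second space
(`exists_holmstedtSum_le_left`); on the second one, `χ₁(u) K(u, g) ≤ 2 u ‖g‖` controls the terms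
with the norm of the first space (`exists_holmstedtSum_le_right`).
-/

noncomputable section

namespace LimitingInterpolation

/-! ### Weighted Lebesgue norms -/

/-- The weight `x ^ (α - 1/q) a(x)` of the norm `wNorm α q a`. -/
def weight (α : ℝ) (q : ℝ≥0∞) (a : ℝ → ℝ) (x : ℝ) : ℝ≥0∞ :=
  ENNReal.ofReal (x ^ (α - (q⁻¹).toReal) * a x)

variable {α β : ℝ} {q r : ℝ≥0∞} {a b : ℝ → ℝ} {I J : Set ℝ} {F G H : ℝ → ℝ≥0∞}

lemma wNorm_eq : wNorm α q a I F =
    eLpNorm (fun x => weight α q a x * F x) q (volume.restrict I) := rfl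

lemma aemeasurable_weight (ha : AEMeasurable a (volume.restrict (Ioi 0))) (hI : I ⊆ Ioi 0) :
    AEMeasurable (weight α q a) (volume.restrict I) :=
  ((measurable_id.pow_const _).aemeasurable.mul
    (ha.mono_measure (Measure.restrict_mono hI le_rfl))).ennreal_ofReal

lemma weight_rpow_mul (α β : ℝ) (q : ℝ≥0∞) (a : ℝ → ℝ) {x : ℝ} (hx : 0 < x) :
    weight α q a x * ENNReal.ofReal (x ^ β) = weight (α + β) q a x := by
  rw [weight, weight, mul_comm, ← ENNReal.ofReal_mul (by positivity), ← mul_assoc,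
    ← Real.rpow_add hx]
  congr 3
  ring

lemma wNorm_mono_set (h : I ⊆ J) : wNorm α q a I F ≤ wNorm α q a J F :=
  eLpNorm_mono_measure _ (Measure.restrict_mono h le_rfl)

lemma wNorm_le_const_mul {c : ℝ≥0∞} (hI : MeasurableSet I) (hc : c ≠ ∞)
    (h : ∀ x ∈ I, weight α q a x * F x ≤ c * (weight β q b x * G x)) :
    wNorm α q a I F ≤ c * wNorm β q b I G := by
  lift c to ℝ≥0 using hc
  exact eLpNorm_le_nnreal_smul_eLpNorm_of_ae_le_mul'
    ((ae_restrict_mem hI).mono fun x hx => h x hx) q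

lemma wNorm_mono (hI : MeasurableSet I) (h : ∀ x ∈ I, F x ≤ G x) :
    wNorm α q a I F ≤ wNorm α q a I G := by
  simpa using wNorm_le_const_mul (c := 1) (α := α) (β := α) (a := a) (b := a) (q := q) hI (by simp)
    (fun x hx => by rw [one_mul]; exact mul_le_mul_right (h x hx) _)

lemma wNorm_le_mul {c : ℝ≥0∞} (hI : MeasurableSet I) (hc : c ≠ ∞)
    (h : ∀ x ∈ I, F x ≤ c * G x) : wNorm α q a I F ≤ c * wNorm α q a I G :=
  wNorm_le_const_mul hI hc fun x hx =>
    (mul_le_mul_right (h x hx) _).trans_eq (by ring)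

/-- No measurability is needed in this direction, and `c = ∞` is allowed; the reverse inequality
`wNorm_le_mul` needs `c ≠ ∞` because `G` may be non-measurable there. -/
lemma const_mul_wNorm_le {c : ℝ≥0∞} (hI : MeasurableSet I) (h : ∀ x ∈ I, c * G x ≤ F x) :
    c * wNorm α q a I G ≤ wNorm α q a I F := by
  have key : ∀ d : ℝ≥0, (d : ℝ≥0∞) ≤ c → d * wNorm α q a I G ≤ wNorm α q a I F := by
    intro d hd
    rcases eq_or_ne d 0 with rfl | hd0
    · simp
    have hd0' : (d : ℝ≥0∞) ≠ 0 := by simpa using hd0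
    have := wNorm_le_mul (α := α) (q := q) (a := a) (F := G) (G := F) (c := (d : ℝ≥0∞)⁻¹) hI
      (by simpa using hd0) (fun x hx => by
        rw [mul_comm, ← div_eq_mul_inv, ENNReal.le_div_iff_mul_le (.inl hd0') (.inl (by simp)),
          mul_comm]
        exact (mul_le_mul_left hd _).trans (h x hx))
    rwa [mul_comm, ← div_eq_mul_inv, ENNReal.le_div_iff_mul_le (.inl hd0') (.inl (by simp)),
      mul_comm] at this
  rcases eq_or_ne c ∞ with rfl | hc
  · rw [← ENNReal.iSup_natCast, ENNReal.iSup_mul]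
    exact iSup_le fun n => by simpa using key n (by simp)
  · lift c to ℝ≥0 using hc
    exact key c le_rfl

lemma wNorm_const_le (ha : AEMeasurable a (volume.restrict (Ioi 0)))
    (hI0 : I ⊆ Ioi 0) (c : ℝ≥0∞) :
    wNorm α q a I (fun _ => c) ≤ wNorm α q a I (fun _ => 1) * c := by
  rw [mul_comm]
  simp only [wNorm_eq, mul_one]
  have hw : AEStronglyMeasurable (weight α q a) (volume.restrict I) :=
    (aemeasurable_weight ha hI0).aestronglyMeasurable
  refine eLpNorm_le_mul_eLpNorm_of_ae_le_mul'' q hw (.of_forall fun x => ?_)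
  simp only [enorm_eq_self]
  exact (mul_comm _ _).le

lemma wNorm_rpow_mul (α β : ℝ) (q : ℝ≥0∞) (a : ℝ → ℝ) (hI : MeasurableSet I) (hI0 : I ⊆ Ioi 0)
    (F : ℝ → ℝ≥0∞) :
    wNorm α q a I (fun x => ENNReal.ofReal (x ^ β) * F x) = wNorm (α + β) q a I F := by
  have : ∀ x ∈ I, weight α q a x * (ENNReal.ofReal (x ^ β) * F x)
      = weight (α + β) q a x * F x := fun x hx => by
    rw [← mul_assoc, weight_rpow_mul _ _ _ _ (hI0 hx)]
  refine le_antisymm ?_ ?_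
  · simpa using wNorm_le_const_mul (c := 1) (α := α) (β := α + β) (a := a) (b := a) (q := q) hI
      (by simp) (fun x hx => by rw [one_mul]; exact (this x hx).le)
  · simpa using wNorm_le_const_mul (c := 1) (α := α + β) (β := α) (a := a) (b := a) (q := q) hI
      (by simp) (fun x hx => by rw [one_mul]; exact (this x hx).ge)

lemma wNorm_add_le (ha : AEMeasurable a (volume.restrict (Ioi 0))) (hI0 : I ⊆ Ioi 0)
    (hF : Measurable F) (hG : Measurable G) :
    wNorm α q a I (fun x => F x + G x) ≤
      ENNReal.LpAddConst q * (wNorm α q a I F + wNorm α q a I G) := by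
  have hw := aemeasurable_weight (α := α) (q := q) ha hI0
  have := eLpNorm_add_le' (hw.mul hF.aemeasurable).aestronglyMeasurable
    (hw.mul hG.aemeasurable).aestronglyMeasurable q
  refine le_trans (le_of_eq ?_) this
  rw [wNorm_eq]
  congr 1
  ext x
  simp [mul_add]

lemma wNorm_union_le (ha : AEMeasurable a (volume.restrict (Ioi 0))) (hI : MeasurableSet I)
    (hJ : MeasurableSet J) (hI0 : I ⊆ Ioi 0) (hJ0 : J ⊆ Ioi 0) (hF : Measurable F) :
    wNorm α q a (I ∪ J) F ≤ ENNReal.LpAddConst q * (wNorm α q a I F + wNorm α q a J F) := by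
  set g : ℝ → ℝ≥0∞ := fun x => weight α q a x * F x with hg
  have hgm : ∀ {S : Set ℝ}, MeasurableSet S → S ⊆ Ioi 0 →
      AEStronglyMeasurable (S.indicator g) volume := fun hS hS0 =>
    (aestronglyMeasurable_indicator_iff hS).2 ((aemeasurable_weight (α := α) (q := q) ha hS0).mul
      hF.aemeasurable).aestronglyMeasurable
  simp only [wNorm_eq, ← hg]
  rw [← eLpNorm_indicator_eq_eLpNorm_restrict (hI.union hJ),
    ← eLpNorm_indicator_eq_eLpNorm_restrict hI, ← eLpNorm_indicator_eq_eLpNorm_restrict hJ]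
  refine le_trans (eLpNorm_mono_enorm fun x => ?_) (eLpNorm_add_le' (hgm hI hI0) (hgm hJ hJ0) q)
  simp only [enorm_eq_self, Pi.add_apply, indicator, mem_union]
  split_ifs <;> simp_all

lemma monotone_wNorm_Ioo_right (α : ℝ) (q : ℝ≥0∞) (a : ℝ → ℝ) (c : ℝ) (F : ℝ → ℝ≥0∞) :
    Monotone fun s => wNorm α q a (Ioo c s) F :=
  fun _ _ h => wNorm_mono_set (Ioo_subset_Ioo_right h)

/-- Change of variables `x ↦ l x` in a weighted norm. -/
lemma wNorm_comp_mul {l : ℝ} (hl : 0 < l) (hI0 : I ⊆ Ioi 0) (hI : MeasurableSet I) :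
    wNorm α q a I F = ENNReal.ofReal (l ^ α) *
      wNorm α q (fun x => a (l * x)) ((l * ·) ⁻¹' I) (fun x => F (l * x)) := by
  have hme : MeasurableEmbedding (l * · : ℝ → ℝ) :=
    (Homeomorph.mulLeft₀ l hl.ne').measurableEmbedding
  have hJ : MeasurableSet ((l * ·) ⁻¹' I) := hme.measurable hI
  have hvol : volume.restrict I =
      ENNReal.ofReal l • Measure.map (l * ·) (volume.restrict ((l * ·) ⁻¹' I)) := by
    rw [← hme.restrict_map, Real.map_volume_mul_left hl.ne', Measure.restrict_smul, smul_smul,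
      ← ENNReal.ofReal_mul hl.le, abs_of_pos (inv_pos.2 hl), mul_inv_cancel₀ hl.ne']
    simp
  have h0 : wNorm α q a I F = ENNReal.ofReal (l ^ (q⁻¹).toReal) *
      eLpNorm (fun x => weight α q a (l * x) * F (l * x)) q
        (volume.restrict ((l * ·) ⁻¹' I)) := by
    rw [wNorm_eq, hvol, eLpNorm_smul_measure_of_ne_zero (by simpa using hl),
      hme.eLpNorm_map_measure, smul_eq_mul, one_div, ENNReal.ofReal_rpow_of_pos hl]
    rfl
  have hpt : ∀ x ∈ (l * ·) ⁻¹' I, weight α q a (l * x) =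
      ENNReal.ofReal (l ^ (α - (q⁻¹).toReal)) * weight α q (fun x => a (l * x)) x := by
    intro x hx
    have hx0 : 0 < x := pos_of_mul_pos_right (hI0 hx) hl.le
    rw [weight, weight, ← ENNReal.ofReal_mul (by positivity), Real.mul_rpow hl.le hx0.le,
      mul_assoc]
  have hle : eLpNorm (fun x => weight α q a (l * x) * F (l * x)) q
        (volume.restrict ((l * ·) ⁻¹' I)) = ENNReal.ofReal (l ^ (α - (q⁻¹).toReal)) *
      wNorm α q (fun x => a (l * x)) ((l * ·) ⁻¹' I) (fun x => F (l * x)) := by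
    set c : ℝ≥0 := (l ^ (α - (q⁻¹).toReal)).toNNReal with hc
    have hc0 : c ≠ 0 := by simp only [hc, ne_eq, Real.toNNReal_eq_zero, not_le]; positivity
    have e : eLpNorm (fun x => weight α q a (l * x) * F (l * x)) q
        (volume.restrict ((l * ·) ⁻¹' I)) = eLpNorm (c • fun x =>
          weight α q (fun x => a (l * x)) x * F (l * x)) q (volume.restrict ((l * ·) ⁻¹' I)) := by
      refine eLpNorm_congr_ae ((ae_restrict_mem hJ).mono fun x hx => ?_)
      simp only [Pi.smul_apply, hpt x hx, ENNReal.smul_def, smul_eq_mul, mul_assoc]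
      rfl
    rw [e]
    refine le_antisymm ?_ ?_
    · exact eLpNorm_le_nnreal_smul_eLpNorm_of_ae_le_mul' (.of_forall fun x => le_rfl) q
    · have := eLpNorm_le_nnreal_smul_eLpNorm_of_ae_le_mul' (c := c⁻¹) (p := q)
        (f := fun x => weight α q (fun x => a (l * x)) x * F (l * x))
        (g := c • fun x => weight α q (fun x => a (l * x)) x * F (l * x))
        (μ := volume.restrict ((l * ·) ⁻¹' I)) (.of_forall fun x => by
          simp only [Pi.smul_apply, enorm_eq_self, ENNReal.smul_def, smul_eq_mul]
          rw [← mul_assoc, ← ENNReal.coe_mul, inv_mul_cancel₀ hc0]; simp)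
      rw [ENNReal.smul_def, smul_eq_mul, ENNReal.coe_inv hc0, mul_comm, ← div_eq_mul_inv,
        ENNReal.le_div_iff_mul_le (.inl (by simpa using hc0)) (.inl (by simp)), mul_comm] at this
      exact this
  rw [h0, hle, ← mul_assoc, ← ENNReal.ofReal_mul (by positivity), ← Real.rpow_add hl]
  congr 3
  ring

/-! ### Slowly varying functions -/

/-- Potter's bound: the values of a slowly varying function at two points differ at most by a
constant times an arbitrarily small power of the ratio of the points. -/
lemma IsSlowlyVarying.exists_le_rpow_mul (ha : IsSlowlyVarying a) {ε : ℝ} (hε : 0 < ε) :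
    ∃ C : ℝ, 0 < C ∧ ∀ x y : ℝ, 0 < x → 0 < y → a x ≤ C * max (x / y) (y / x) ^ ε * a y := by
  obtain ⟨g, hg, c, hc, hgc⟩ := ha.equiv_increasing ε hε
  obtain ⟨h, hh, d, hd, hhd⟩ := ha.equiv_decreasing ε hε
  refine ⟨c * c + d * d, by positivity, fun x y hx hy => ?_⟩
  have hax := ha.pos x hx
  have hay := ha.pos y hy
  rcases le_total x y with hxy | hxy
  · have h1 : x ^ ε * a x ≤ c * c * (y ^ ε * a y) :=
      calc x ^ ε * a x ≤ c * g x := (hgc x hx).1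
        _ ≤ c * g y := by gcongr; exact hg hx hy hxy
        _ ≤ c * (c * (y ^ ε * a y)) := by gcongr; exact (hgc y hy).2
        _ = _ := by ring
    calc a x ≤ c * c * (y / x) ^ ε * a y := by
          rw [Real.div_rpow hy.le hx.le]
          rw [← mul_le_mul_iff_right₀ (Real.rpow_pos_of_pos hx ε)]
          refine h1.trans_eq ?_
          have := (Real.rpow_pos_of_pos hx ε).ne'
          field_simp
      _ ≤ _ := by
          gcongr
          · nlinarith
          · exact le_max_right _ _
  · have h1 : x ^ (-ε) * a x ≤ d * d * (y ^ (-ε) * a y) :=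
      calc x ^ (-ε) * a x ≤ d * h x := (hhd x hx).1
        _ ≤ d * h y := by gcongr; exact hh hy hx hxy
        _ ≤ d * (d * (y ^ (-ε) * a y)) := by gcongr; exact (hhd y hy).2
        _ = _ := by ring
    calc a x ≤ d * d * (x / y) ^ ε * a y := by
          rw [Real.div_rpow hx.le hy.le]
          rw [← mul_le_mul_iff_right₀ (Real.rpow_pos_of_pos hx (-ε))]
          refine h1.trans_eq ?_
          have h2 := (Real.rpow_pos_of_pos hx ε).ne'
          have h3 := (Real.rpow_pos_of_pos hy ε).ne'
          rw [Real.rpow_neg hx.le, Real.rpow_neg hy.le]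
          field_simp
      _ ≤ _ := by
          gcongr
          · nlinarith
          · exact le_max_left _ _

lemma weight_pos {x : ℝ} (hx : 0 < x) (ha : 0 < a x) : 0 < weight α q a x :=
  ENNReal.ofReal_pos.2 (mul_pos (Real.rpow_pos_of_pos hx _) ha)

lemma wNorm_one_pos (hq : 0 < q) (ha : IsSlowlyVarying a) {c d : ℝ} (hc : 0 ≤ c) (hcd : c < d) :
    0 < wNorm α q a (Ioo c d) fun _ => 1 := by
  have hI : Ioo c d ⊆ Ioi 0 := fun x hx => hc.trans_lt hx.1
  rw [pos_iff_ne_zero, wNorm_eq]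
  simp only [mul_one]
  intro h
  have hw : AEStronglyMeasurable (weight α q a) (volume.restrict (Ioo c d)) :=
    (aemeasurable_weight ha.measurable hI).aestronglyMeasurable
  rw [eLpNorm_eq_zero_iff hw hq.ne'] at h
  have h2 : ∀ᵐ _x ∂(volume.restrict (Ioo c d)), False := by
    filter_upwards [h, ae_restrict_mem measurableSet_Ioo] with x hx hxI
    exact (weight_pos (hI hxI) (ha.pos x (hI hxI))).ne' hx
  rw [ae_iff] at h2
  simp [hcd.not_ge] at h2

lemma preimage_mul_Ioo {l : ℝ} (hl : 0 < l) (c d : ℝ) :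
    (l * ·) ⁻¹' Ioo (l * c) (l * d) = Ioo c d := by
  ext x; simp only [mem_preimage, mem_Ioo, mul_lt_mul_iff_right₀ hl]

lemma preimage_mul_Ioi {l : ℝ} (hl : 0 < l) (c : ℝ) :
    (l * ·) ⁻¹' Ioi (l * c) = Ioi c := by
  ext x; simp only [mem_preimage, mem_Ioi, mul_lt_mul_iff_right₀ hl]

lemma wNorm_rpow_lt_top_Ioo (hq : 0 < q) (hα : 0 < α) :
    wNorm α q (fun _ => 1) (Ioo 0 1) (fun _ => 1) < ∞ := by
  rw [wNorm_eq]
  simp only [mul_one]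
  rcases eq_or_ne q ∞ with rfl | hq'
  · rw [eLpNorm_exponent_top]
    refine lt_of_le_of_lt (essSup_le_of_ae_le (1 : ℝ≥0∞) ?_) ENNReal.one_lt_top
    filter_upwards [ae_restrict_mem measurableSet_Ioo] with x hx
    simp only [weight, enorm_eq_self, mul_one, ENNReal.inv_top, ENNReal.toReal_zero, sub_zero]
    exact ENNReal.ofReal_le_one.2 (Real.rpow_le_one hx.1.le hx.2.le hα.le)
  · rw [eLpNorm_lt_top_iff_lintegral_rpow_enorm_lt_top hq.ne' hq']
    have hq0 := ENNReal.toReal_pos hq.ne' hq'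
    have hint : IntegrableOn (fun x : ℝ => x ^ (α * q.toReal - 1)) (Ioo 0 1) :=
      (intervalIntegral.integrableOn_Ioo_rpow_iff one_pos).2 (by nlinarith [mul_pos hα hq0])
    refine lt_of_le_of_lt (le_of_eq ?_) hint.lintegral_lt_top
    refine setLIntegral_congr_fun measurableSet_Ioo fun x hx => ?_
    simp only [weight, enorm_eq_self, mul_one]
    rw [ENNReal.ofReal_rpow_of_pos (Real.rpow_pos_of_pos hx.1 _), ← Real.rpow_mul hx.1.le,
      ENNReal.toReal_inv, sub_mul, inv_mul_cancel₀ hq0.ne']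

lemma wNorm_rpow_lt_top_Ioi (hq : 0 < q) (hα : 0 < α) :
    wNorm (-α) q (fun _ => 1) (Ioi 1) (fun _ => 1) < ∞ := by
  rw [wNorm_eq]
  simp only [mul_one]
  rcases eq_or_ne q ∞ with rfl | hq'
  · rw [eLpNorm_exponent_top]
    refine lt_of_le_of_lt (essSup_le_of_ae_le (1 : ℝ≥0∞) ?_) ENNReal.one_lt_top
    filter_upwards [ae_restrict_mem measurableSet_Ioi] with x hx
    simp only [weight, enorm_eq_self, mul_one, ENNReal.inv_top, ENNReal.toReal_zero, sub_zero]
    exact ENNReal.ofReal_le_one.2 (Real.rpow_le_one_of_one_le_of_nonpos (mem_Ioi.1 hx).le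
      (neg_nonpos.2 hα.le))
  · rw [eLpNorm_lt_top_iff_lintegral_rpow_enorm_lt_top hq.ne' hq']
    have hq0 := ENNReal.toReal_pos hq.ne' hq'
    have hint : IntegrableOn (fun x : ℝ => x ^ (-α * q.toReal - 1)) (Ioi 1) :=
      integrableOn_Ioi_rpow_of_lt (by nlinarith [mul_pos hα hq0]) one_pos
    refine lt_of_le_of_lt (le_of_eq ?_) hint.lintegral_lt_top
    refine setLIntegral_congr_fun measurableSet_Ioi fun x hx => ?_
    have hx0 : (0 : ℝ) < x := one_pos.trans hx
    simp only [weight, enorm_eq_self, mul_one]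
    rw [ENNReal.ofReal_rpow_of_pos (Real.rpow_pos_of_pos hx0 _), ← Real.rpow_mul hx0.le,
      ENNReal.toReal_inv, sub_mul, inv_mul_cancel₀ hq0.ne']

/-- Over a set on which Potter's bound reads `a (t x) ≤ C x ^ β a t`, a weighted norm of `1` is
controlled by the value of `a` at `t`; this is the substitution `x ↦ t x`. -/
lemma wNorm_one_le_of_rpow {t C : ℝ} (ht : 0 < t) (hC : 0 ≤ C) (hat : 0 ≤ a t)
    (hJ : MeasurableSet J)
    (hI : MeasurableSet I) (hI0 : I ⊆ Ioi 0) (hIJ : (t * ·) ⁻¹' I = J)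
    (h : ∀ x ∈ J, a (t * x) ≤ C * x ^ β * a t) :
    wNorm α q a I (fun _ => 1) ≤ ENNReal.ofReal C * wNorm (α + β) q (fun _ => 1) J (fun _ => 1)
      * ENNReal.ofReal (t ^ α) * ENNReal.ofReal (a t) := by
  have hJ0 : J ⊆ Ioi 0 := by
    rintro x hx
    rw [← hIJ] at hx
    exact pos_of_mul_pos_right (hI0 hx) ht.le
  rw [wNorm_comp_mul ht hI0 hI, hIJ]
  have : wNorm α q (fun x => a (t * x)) J (fun _ => 1) ≤
      (ENNReal.ofReal C * ENNReal.ofReal (a t)) * wNorm (α + β) q (fun _ => 1) J (fun _ => 1) := by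
    refine wNorm_le_const_mul hJ (ENNReal.mul_ne_top ENNReal.ofReal_ne_top ENNReal.ofReal_ne_top)
      fun x hx => ?_
    have hx0 : 0 < x := hJ0 hx
    simp only [mul_one, weight]
    rw [← ENNReal.ofReal_mul hC, ← ENNReal.ofReal_mul (by positivity)]
    refine ENNReal.ofReal_le_ofReal ?_
    calc _ ≤ x ^ (α - (q⁻¹).toReal) * (C * x ^ β * a t) := by gcongr; exact h x hx
      _ = C * a t * (x ^ (α - (q⁻¹).toReal) * x ^ β) := by ring
      _ = _ := by rw [← Real.rpow_add hx0]; congr 2; ring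
  calc _ ≤ _ := mul_le_mul_right this _
    _ = _ := by ring

/-- `‖u ^ (α - 1/q) a(u)‖_{q, (0, t)} ≲ t ^ α a(t)` for `α > 0`. -/
lemma IsSlowlyVarying.exists_wNorm_Ioo_le (ha : IsSlowlyVarying a) (hq : 0 < q) (hα : 0 < α) :
    ∃ C : ℝ≥0, ∀ t : ℝ, 0 < t → wNorm α q a (Ioo 0 t) (fun _ => 1) ≤
      C * ENNReal.ofReal (t ^ α) * ENNReal.ofReal (a t) := by
  obtain ⟨C, hC, h⟩ := ha.exists_le_rpow_mul (half_pos hα)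
  have hfin := wNorm_rpow_lt_top_Ioo (q := q) hq (show 0 < α + -(α / 2) by linarith)
  refine ⟨(ENNReal.ofReal C * wNorm (α + -(α / 2)) q (fun _ => 1) (Ioo 0 1)
    (fun _ => 1)).toNNReal, fun t ht => ?_⟩
  rw [ENNReal.coe_toNNReal (ENNReal.mul_ne_top ENNReal.ofReal_ne_top hfin.ne)]
  refine wNorm_one_le_of_rpow ht hC.le (ha.pos t ht).le measurableSet_Ioo measurableSet_Ioo
    (fun x hx => hx.1) ?_ fun x hx => ?_
  · simpa using preimage_mul_Ioo ht 0 1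
  · refine (h _ t (mul_pos ht hx.1) ht).trans_eq ?_
    rw [mul_div_cancel_left₀ _ ht.ne', div_mul_cancel_left₀ ht.ne', max_eq_right,
      Real.inv_rpow hx.1.le,
      Real.rpow_neg hx.1.le]
    exact hx.2.le.trans ((one_le_inv₀ hx.1).2 hx.2.le)

/-- `‖u ^ (-α - 1/q) a(u)‖_{q, (t, ∞)} ≲ t ^ (-α) a(t)` for `α > 0`. -/
lemma IsSlowlyVarying.exists_wNorm_Ioi_le (ha : IsSlowlyVarying a) (hq : 0 < q) (hα : 0 < α) :
    ∃ C : ℝ≥0, ∀ t : ℝ, 0 < t → wNorm (-α) q a (Ioi t) (fun _ => 1) ≤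
      C * ENNReal.ofReal (t ^ (-α)) * ENNReal.ofReal (a t) := by
  obtain ⟨C, hC, h⟩ := ha.exists_le_rpow_mul (half_pos hα)
  have hfin := wNorm_rpow_lt_top_Ioi (q := q) hq (half_pos hα)
  rw [show -(α / 2) = -α + α / 2 by ring] at hfin
  refine ⟨(ENNReal.ofReal C * wNorm (-α + α / 2) q (fun _ => 1) (Ioi 1)
    (fun _ => 1)).toNNReal, fun t ht => ?_⟩
  rw [ENNReal.coe_toNNReal (ENNReal.mul_ne_top ENNReal.ofReal_ne_top hfin.ne)]
  refine wNorm_one_le_of_rpow ht hC.le (ha.pos t ht).le measurableSet_Ioi measurableSet_Ioi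
    (fun x hx => ht.trans hx) ?_ fun x hx => ?_
  · simpa using preimage_mul_Ioi ht 1
  · have hx0 : (0 : ℝ) < x := one_pos.trans hx
    refine (h _ t (mul_pos ht hx0) ht).trans_eq ?_
    rw [mul_div_cancel_left₀ _ ht.ne', div_mul_cancel_left₀ ht.ne', max_eq_left]
    exact ((inv_le_one₀ hx0).2 (le_of_lt hx)).trans (le_of_lt hx)

/-- Potter's bound for the values in `ℝ≥0∞`, at two points of comparable size. -/
lemma IsSlowlyVarying.exists_ofReal_le (ha : IsSlowlyVarying a) {k : ℝ} (hk : 0 < k) :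
    ∃ C : ℝ≥0, 0 < C ∧ ∀ x y : ℝ, 0 < x → 0 < y → x ≤ k * y → y ≤ k * x →
      ENNReal.ofReal (a x) ≤ C * ENNReal.ofReal (a y) := by
  obtain ⟨C, hC, h⟩ := ha.exists_le_rpow_mul one_pos
  refine ⟨(C * k).toNNReal, by simp only [Real.toNNReal_pos]; positivity,
    fun x y hx hy hxy hyx => ?_⟩
  change _ ≤ ENNReal.ofReal (C * k) * _
  rw [← ENNReal.ofReal_mul (by positivity)]
  refine ENNReal.ofReal_le_ofReal ((h x y hx hy).trans ?_)
  have := (ha.pos y hy).le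
  gcongr
  rw [Real.rpow_one, max_le_iff, div_le_iff₀ hy, div_le_iff₀ hx]
  exact ⟨hxy, hyx⟩

lemma wNorm_zero_le_wNorm_one {c d : ℝ} (hc : 0 < c) : wNorm 0 q a (Ioo c d) (fun _ => 1) ≤
    ENNReal.ofReal c⁻¹ * wNorm 1 q a (Ioo 0 d) (fun _ => 1) := by
  refine (wNorm_le_const_mul measurableSet_Ioo ENNReal.ofReal_ne_top fun x hx => ?_).trans
    (mul_le_mul_right (wNorm_mono_set (Ioo_subset_Ioo_left hc.le)) _)
  have hx0 := hc.trans hx.1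
  simp only [mul_one]
  rw [show (1 : ℝ) = 0 + 1 by ring, ← weight_rpow_mul _ _ _ _ hx0, Real.rpow_one, mul_comm,
    mul_assoc, ← ENNReal.ofReal_mul hx0.le]
  refine le_mul_of_one_le_right' (ENNReal.one_le_ofReal.2 ?_)
  rw [← div_eq_mul_inv, one_le_div hc]
  exact hx.1.le

/-- `a(t) ≲ ‖u ^ (-1/q) a(u)‖_{q, (c t, d t)}`. -/
lemma IsSlowlyVarying.exists_le_wNorm (ha : IsSlowlyVarying a) (hq : 0 < q) {c d : ℝ} (hc : 0 < c)
    (hcd : c < d) : ∃ C : ℝ≥0, ∀ t : ℝ, 0 < t →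
      ENNReal.ofReal (a t) ≤ C * wNorm 0 q a (Ioo (t * c) (t * d)) (fun _ => 1) := by
  obtain ⟨C, hC, h⟩ := ha.exists_ofReal_le (k := max d c⁻¹) (by positivity)
  -- By dilation the norm at `t` is comparable to `a t / a 1` times its value `P` at `t = 1`.
  set P := wNorm 0 q a (Ioo c d) (fun _ => 1) with hP
  have hP0 : P ≠ 0 := (wNorm_one_pos hq ha hc.le hcd).ne'
  have h1c := fun x (hx : x ∈ Ioo c d) => h x 1 (hc.trans hx.1) one_pos
    (by rw [mul_one]; exact hx.2.le.trans (le_max_left _ _))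
    (by
      have : c⁻¹ * c ≤ max d c⁻¹ * x := by gcongr; exacts [le_max_right _ _, hx.1.le]
      rwa [inv_mul_cancel₀ hc.ne'] at this)
  have ha1 : ENNReal.ofReal (a 1) ≠ 0 := by simpa using ha.pos 1 one_pos
  refine ⟨C * C * (ENNReal.ofReal (a 1) * P⁻¹).toNNReal, fun t ht => ?_⟩
  rw [wNorm_comp_mul ht (fun x hx => (mul_pos ht hc).trans hx.1) measurableSet_Ioo,
    preimage_mul_Ioo ht, Real.rpow_zero, ENNReal.ofReal_one, one_mul]
  have key : ENNReal.ofReal (a t) * P ≤ (C * C * ENNReal.ofReal (a 1)) *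
      wNorm 0 q (fun x => a (t * x)) (Ioo c d) (fun _ => 1) := by
    refine (const_mul_wNorm_le (F := fun _ => ENNReal.ofReal (a t)) measurableSet_Ioo
      (fun _ _ => (mul_one _).le)).trans ?_
    refine wNorm_le_const_mul measurableSet_Ioo (by finiteness) fun x hx => ?_
    have hx0 := hc.trans hx.1
    have e1 := h t (t * x) ht (mul_pos ht hx0)
      (by
        have : c⁻¹ * (t * c) ≤ max d c⁻¹ * (t * x) := by gcongr; exacts [le_max_right _ _, hx.1.le]
        refine le_trans (le_of_eq ?_) this
        field_simp)
      (by
        have : t * x ≤ t * max d c⁻¹ := by gcongr; exact hx.2.le.trans (le_max_left _ _)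
        linarith)
    simp only [weight, mul_one]
    rw [ENNReal.ofReal_mul (by positivity), ENNReal.ofReal_mul (by positivity)]
    calc _ ≤ ENNReal.ofReal (x ^ (0 - (q⁻¹).toReal)) * (C * ENNReal.ofReal (a 1)) *
          (C * ENNReal.ofReal (a (t * x))) := by
            gcongr
            exact h1c x hx
      _ = _ := by ring
  have hPtop : P ≠ ∞ := by
    obtain ⟨M, hM⟩ := ha.exists_wNorm_Ioo_le hq (one_pos (α := ℝ))
    refine ((wNorm_zero_le_wNorm_one hc).trans_lt (ENNReal.mul_lt_top ENNReal.ofReal_lt_top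
      ((hM d (hc.trans hcd)).trans_lt ?_))).ne
    finiteness
  rw [← ENNReal.le_div_iff_mul_le (.inl hP0) (.inl hPtop)] at key
  refine key.trans_eq ?_
  push_cast
  rw [ENNReal.coe_toNNReal (by finiteness), div_eq_mul_inv]
  ring

lemma IsSlowlyVarying.exists_wNorm_le (ha : IsSlowlyVarying a) (hq : 0 < q) {c d : ℝ} (hc : 0 < c)
    (hcd : c < d) : ∃ C : ℝ≥0, ∀ t : ℝ, 0 < t →
      wNorm 0 q a (Ioo (t * c) (t * d)) (fun _ => 1) ≤ C * ENNReal.ofReal (a t) := by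
  obtain ⟨M, hM⟩ := ha.exists_wNorm_Ioo_le hq (one_pos (α := ℝ))
  have hd := hc.trans hcd
  obtain ⟨D, hD, h1⟩ := ha.exists_ofReal_le (k := max d d⁻¹) (by positivity)
  refine ⟨(c⁻¹ * d).toNNReal * M * D, fun t ht => ?_⟩
  have h2 := wNorm_zero_le_wNorm_one (q := q) (a := a) (d := t * d) (mul_pos ht hc)
  have e1 := h1 (t * d) t (by positivity) ht
    (by rw [mul_comm]; gcongr; exact le_max_left _ _)
    (by
      have : d⁻¹ * (t * d) ≤ max d d⁻¹ * (t * d) := by gcongr; exact le_max_right _ _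
      refine le_trans (le_of_eq ?_) this
      field_simp)
  calc _ ≤ _ := h2
    _ ≤ ENNReal.ofReal (t * c)⁻¹ * (M * ENNReal.ofReal ((t * d) ^ (1 : ℝ)) *
        (D * ENNReal.ofReal (a t))) := by
        gcongr
        exact (hM _ (by positivity)).trans (by gcongr)
    _ = (ENNReal.ofReal (t * c)⁻¹ * ENNReal.ofReal (t * d)) * M * D * ENNReal.ofReal (a t) := by
        rw [Real.rpow_one]; ring
    _ = _ := by
        rw [← ENNReal.ofReal_mul (by positivity),
          show (t * c)⁻¹ * (t * d) = c⁻¹ * d by field_simp]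
        simp [ENNReal.ofReal]

/-! ### Functions of power-bounded variation and the functions `χ₀`, `χ₁` -/

/-- `ψ u ≤ D max (u/t) (t/u) ^ η ψ t` for all `u, t > 0`: a function that varies no faster than the
powers of exponent `±η`. -/
def PowerBounded (D : ℝ≥0) (η : ℝ) (ψ : ℝ → ℝ≥0∞) : Prop :=
  ∀ u t : ℝ, 0 < u → 0 < t → ψ u ≤ D * ENNReal.ofReal (max (u / t) (t / u) ^ η) * ψ t

lemma IsSlowlyVarying.exists_powerBounded (ha : IsSlowlyVarying a) {ε : ℝ} (hε : 0 < ε) :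
    ∃ D, PowerBounded D ε fun t => ENNReal.ofReal (a t) := by
  obtain ⟨C, hC, h⟩ := ha.exists_le_rpow_mul hε
  refine ⟨C.toNNReal, fun u t hu ht => ?_⟩
  change _ ≤ ENNReal.ofReal C * _ * _
  rw [← ENNReal.ofReal_mul hC.le, ← ENNReal.ofReal_mul (by positivity)]
  exact ENNReal.ofReal_le_ofReal (h u t hu ht)

lemma PowerBounded.mul {D D' : ℝ≥0} {η η' : ℝ} {ψ φ : ℝ → ℝ≥0∞} (h : PowerBounded D η ψ)
    (h' : PowerBounded D' η' φ) : PowerBounded (D * D') (η + η') fun t => ψ t * φ t := by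
  intro u t hu ht
  have hm : 0 < max (u / t) (t / u) := lt_max_of_lt_left (by positivity)
  calc ψ u * φ u ≤ _ := mul_le_mul' (h u t hu ht) (h' u t hu ht)
    _ = _ := by
      rw [Real.rpow_add hm, ENNReal.ofReal_mul (by positivity), ENNReal.coe_mul]
      ring

lemma PowerBounded.inv {D : ℝ≥0} {η : ℝ} {ψ : ℝ → ℝ≥0∞} (h : PowerBounded D η ψ)
    (h0 : ∀ t, 0 < t → ψ t ≠ 0) (htop : ∀ t, 0 < t → ψ t ≠ ∞) :
    PowerBounded D η fun t => (ψ t)⁻¹ := by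
  intro u t hu ht
  have h1 := h t u ht hu
  rw [max_comm] at h1
  calc (ψ u)⁻¹ = (ψ t)⁻¹ * ψ t * (ψ u)⁻¹ := by
        rw [ENNReal.inv_mul_cancel (h0 t ht) (htop t ht), one_mul]
    _ ≤ (ψ t)⁻¹ * (D * ENNReal.ofReal (max (u / t) (t / u) ^ η) * ψ u) * (ψ u)⁻¹ := by gcongr
    _ = D * ENNReal.ofReal (max (u / t) (t / u) ^ η) * (ψ t)⁻¹ * ((ψ u)⁻¹ * ψ u) := by ring
    _ = _ := by rw [ENNReal.inv_mul_cancel (h0 u hu) (htop u hu), mul_one]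

/-- `‖u ^ (-1 - 1/q) a(u) ψ(u)‖_{q, (t, s)} ≲ t⁻¹ a(t) ψ(t)` if `ψ` varies slower than a power of
exponent smaller than one. -/
lemma PowerBounded.exists_wNorm_Ioo_le_left {D : ℝ≥0} {η : ℝ} {ψ : ℝ → ℝ≥0∞}
    (h : PowerBounded D η ψ) (hη : η < 1) (htop : ∀ t, 0 < t → ψ t ≠ ∞) (ha : IsSlowlyVarying a)
    (hq : 0 < q) : ∃ C : ℝ≥0, ∀ t s : ℝ, 0 < t → wNorm (-1) q a (Ioo t s) ψ ≤
      C * ENNReal.ofReal t⁻¹ * ENNReal.ofReal (a t) * ψ t := by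
  obtain ⟨M, hM⟩ := ha.exists_wNorm_Ioi_le hq (sub_pos.2 hη)
  refine ⟨D * M, fun t s ht => ?_⟩
  have hI : Ioo t s ⊆ Ioi 0 := fun x hx => ht.trans hx.1
  have htη := Real.rpow_pos_of_pos ht η
  have h1 : wNorm (-1) q a (Ioo t s) ψ ≤ (D * ENNReal.ofReal (t ^ (-η)) * ψ t) *
      wNorm (-1) q a (Ioo t s) (fun u => ENNReal.ofReal (u ^ η) * 1) := by
    refine wNorm_le_mul measurableSet_Ioo ?_ fun u hu => ?_
    · exact ENNReal.mul_ne_top (by finiteness) (htop t ht)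
    · have hu0 := hI hu
      refine (h u t hu0 ht).trans_eq ?_
      rw [max_eq_left, Real.div_rpow hu0.le ht.le, div_eq_mul_inv, ← Real.rpow_neg ht.le,
        ENNReal.ofReal_mul (Real.rpow_nonneg hu0.le _)]
      · ring
      · exact ((div_le_one hu0).2 hu.1.le).trans ((one_le_div ht).2 hu.1.le)
  rw [wNorm_rpow_mul _ _ _ _ measurableSet_Ioo hI] at h1
  calc _ ≤ _ := h1
    _ ≤ (D * ENNReal.ofReal (t ^ (-η)) * ψ t) *
        (M * ENNReal.ofReal (t ^ (-(1 - η))) * ENNReal.ofReal (a t)) := by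
      gcongr
      refine le_trans ?_ (hM t ht)
      rw [show -1 + η = -(1 - η) by ring]
      exact wNorm_mono_set Ioo_subset_Ioi_self
    _ = D * M * (ENNReal.ofReal (t ^ (-η)) * ENNReal.ofReal (t ^ (-(1 - η)))) *
        ENNReal.ofReal (a t) * ψ t := by ring
    _ = _ := by
      rw [← ENNReal.ofReal_mul (by positivity), ← Real.rpow_add ht,
        show -η + -(1 - η) = -1 by ring, Real.rpow_neg_one, ENNReal.coe_mul]

/-- `‖u ^ (1 - 1/q) a(u) ψ(u)‖_{q, (0, t)} ≲ t a(t) ψ(t)` if `ψ` varies slower than a power of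
exponent smaller than one. -/
lemma PowerBounded.exists_wNorm_Ioo_le_right {D : ℝ≥0} {η : ℝ} {ψ : ℝ → ℝ≥0∞}
    (h : PowerBounded D η ψ) (hη : η < 1) (htop : ∀ t, 0 < t → ψ t ≠ ∞) (ha : IsSlowlyVarying a)
    (hq : 0 < q) : ∃ C : ℝ≥0, ∀ t : ℝ, 0 < t →
      wNorm 0 q a (Ioo 0 t) (fun u => ENNReal.ofReal u * ψ u) ≤
        C * ENNReal.ofReal t * ENNReal.ofReal (a t) * ψ t := by
  obtain ⟨M, hM⟩ := ha.exists_wNorm_Ioo_le hq (sub_pos.2 hη)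
  refine ⟨D * M, fun t ht => ?_⟩
  have hI : Ioo 0 t ⊆ Ioi 0 := fun x hx => hx.1
  have h1 : wNorm 0 q a (Ioo 0 t) (fun u => ENNReal.ofReal u * ψ u) ≤
      (D * ENNReal.ofReal (t ^ η) * ψ t) *
      wNorm 0 q a (Ioo 0 t) (fun u => ENNReal.ofReal (u ^ (1 - η)) * 1) := by
    refine wNorm_le_mul measurableSet_Ioo ?_ fun u hu => ?_
    · exact ENNReal.mul_ne_top (by finiteness) (htop t ht)
    · have hu0 : 0 < u := hI hu
      refine (mul_le_mul_right (h u t hu0 ht) _).trans_eq ?_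
      rw [max_eq_right (((div_le_one ht).2 hu.2.le).trans ((one_le_div hu0).2 hu.2.le)),
        Real.div_rpow ht.le hu0.le, div_eq_mul_inv, Real.rpow_sub hu0, Real.rpow_one,
        div_eq_mul_inv, ENNReal.ofReal_mul (by positivity), ENNReal.ofReal_mul hu0.le]
      ring
  rw [wNorm_rpow_mul _ _ _ _ measurableSet_Ioo hI, zero_add] at h1
  calc _ ≤ _ := h1
    _ ≤ (D * ENNReal.ofReal (t ^ η) * ψ t) *
        (M * ENNReal.ofReal (t ^ (1 - η)) * ENNReal.ofReal (a t)) := by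
      gcongr
      exact hM t ht
    _ = D * M * (ENNReal.ofReal (t ^ η) * ENNReal.ofReal (t ^ (1 - η))) *
        ENNReal.ofReal (a t) * ψ t := by ring
    _ = _ := by
      rw [← ENNReal.ofReal_mul (by positivity), ← Real.rpow_add ht,
        show η + (1 - η) = 1 by ring, Real.rpow_one, ENNReal.coe_mul]

lemma wNorm_dilate_le {l : ℝ} {M : ℝ≥0∞} (hM : M ≠ ∞) (hl : 0 < l)
    (h : ∀ x, 0 < x → ENNReal.ofReal (a x) ≤ M * ENNReal.ofReal (a (l * x)))
    (hI : MeasurableSet I) (hI0 : I ⊆ Ioi 0) :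
    wNorm 0 q a ((l * ·) ⁻¹' I) (fun x => F (l * x)) ≤ M * wNorm 0 q a I F := by
  rw [wNorm_comp_mul hl hI0 hI, Real.rpow_zero, ENNReal.ofReal_one, one_mul]
  refine wNorm_le_const_mul (measurable_const_mul l hI) hM fun x hx => ?_
  have hx0 : 0 < x := pos_of_mul_pos_right (hI0 hx) hl.le
  rw [weight, weight, ENNReal.ofReal_mul (by positivity), ENNReal.ofReal_mul (by positivity)]
  calc _ ≤ ENNReal.ofReal (x ^ (0 - (q⁻¹).toReal)) * (M * ENNReal.ofReal (a (l * x))) *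
        F (l * x) := by gcongr; exact h x hx0
    _ = _ := by ring

lemma wNorm_dilate_Ioo_le {l c d : ℝ} {M : ℝ≥0∞} (hM : M ≠ ∞) (hl : 0 < l)
    (h : ∀ x, 0 < x → ENNReal.ofReal (a x) ≤ M * ENNReal.ofReal (a (l * x))) (hc : 0 ≤ c) :
    wNorm 0 q a (Ioo c d) (fun x => F (l * x)) ≤ M * wNorm 0 q a (Ioo (l * c) (l * d)) F := by
  rw [← preimage_mul_Ioo hl]
  exact wNorm_dilate_le hM hl h measurableSet_Ioo fun x hx =>
    (mul_nonneg hl.le hc).trans_lt hx.1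

lemma wNorm_dilate_Ioi_le {l c : ℝ} {M : ℝ≥0∞} (hM : M ≠ ∞) (hl : 0 < l)
    (h : ∀ x, 0 < x → ENNReal.ofReal (a x) ≤ M * ENNReal.ofReal (a (l * x))) (hc : 0 ≤ c) :
    wNorm 0 q a (Ioi c) (fun x => F (l * x)) ≤ M * wNorm 0 q a (Ioi (l * c)) F := by
  rw [← preimage_mul_Ioi hl]
  exact wNorm_dilate_le hM hl h measurableSet_Ioi fun x hx =>
    (mul_nonneg hl.le hc).trans_lt hx

/-- The substitution `x ↦ l x` in both norms that define `χ₀`. -/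
lemma chi0_le_dilate {l u : ℝ} {M N : ℝ≥0∞} (hM : M ≠ ∞) (hN : N ≠ ∞) (hl : 0 < l) (hu : 0 < u)
    (ha : ∀ x, 0 < x → ENNReal.ofReal (a x) ≤ M * ENNReal.ofReal (a (l * x)))
    (hb : ∀ x, 0 < x → ENNReal.ofReal (b x) ≤ N * ENNReal.ofReal (b (l * x))) :
    chi0 r b q a u ≤ M * N * chi0 r b q a (l * u) := by
  have h1 : chi0 r b q a u ≤ M * wNorm 0 r b (Ioi u)
      (fun s => wNorm 0 q a (Ioo (l * u) (l * s)) fun _ => 1) :=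
    wNorm_le_mul measurableSet_Ioi hM fun s _ =>
      wNorm_dilate_Ioo_le (F := fun _ => 1) hM hl ha hu.le
  have h2 := wNorm_dilate_Ioi_le (q := r)
    (F := fun s => wNorm 0 q a (Ioo (l * u) s) fun _ => 1) hN hl hb hu.le
  calc _ ≤ _ := h1
    _ ≤ M * (N * chi0 r b q a (l * u)) := mul_le_mul_right h2 _
    _ = _ := by ring

lemma chi1_le_dilate {l u : ℝ} {M N : ℝ≥0∞} (hM : M ≠ ∞) (hN : N ≠ ∞) (hl : 0 < l) (hu : 0 < u)
    (ha : ∀ x, 0 < x → ENNReal.ofReal (a x) ≤ M * ENNReal.ofReal (a (l * x)))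
    (hb : ∀ x, 0 < x → ENNReal.ofReal (b x) ≤ N * ENNReal.ofReal (b (l * x))) :
    chi1 r b q a u ≤ M * N * chi1 r b q a (l * u) := by
  have h0 : ∀ s, wNorm 0 q a (Ioo 0 s) (fun _ => 1) ≤
      M * wNorm 0 q a (Ioo 0 (l * s)) fun _ => 1 := fun s => by
    simpa using wNorm_dilate_Ioo_le (q := q) (F := fun _ => 1) (c := 0) (d := s) hM hl ha le_rfl
  have h1 := wNorm_le_mul (α := 0) (q := r) (a := b) (I := Ioo 0 u) measurableSet_Ioo hM
    fun s _ => h0 s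
  have h2 := wNorm_dilate_Ioo_le (q := r) (c := 0) (d := u)
    (F := fun s => wNorm 0 q a (Ioo 0 s) fun _ => 1) hN hl hb le_rfl
  rw [mul_zero] at h2
  have h3 := wNorm_dilate_Ioi_le (q := r) (F := fun _ => 1) (c := u) hN hl hb hu.le
  calc _ ≤ M * (N * wNorm 0 r b (Ioo 0 (l * u)) fun s => wNorm 0 q a (Ioo 0 s) fun _ => 1) +
        (N * wNorm 0 r b (Ioi (l * u)) fun _ => 1) *
          (M * wNorm 0 q a (Ioo 0 (l * u)) fun _ => 1) :=
        add_le_add (h1.trans (mul_le_mul_right h2 _)) (mul_le_mul' h3 (h0 u))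
    _ = _ := by rw [chi1]; ring

lemma PowerBounded.le_dilate {D : ℝ≥0} {η : ℝ} {ψ : ℝ → ℝ≥0∞} (h : PowerBounded D η ψ) {u t : ℝ}
    (hu : 0 < u) (ht : 0 < t) (x : ℝ) (hx : 0 < x) :
    ψ x ≤ D * ENNReal.ofReal (max (u / t) (t / u) ^ η) * ψ (t / u * x) := by
  convert! h x (t / u * x) hx (by positivity) using 5
  field_simp

/-- `χ₀` varies no faster than the square roots; the exponent is the sum of two exponents `1/4` in
Potter's bounds for `a` and `b`. -/
lemma exists_powerBounded_chi0 (ha : IsSlowlyVarying a) (hb : IsSlowlyVarying b) :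
    ∃ D, PowerBounded D (1 / 2) (chi0 r b q a) := by
  obtain ⟨D, hD⟩ := ha.exists_powerBounded (show (0 : ℝ) < 1 / 4 by norm_num)
  obtain ⟨D', hD'⟩ := hb.exists_powerBounded (show (0 : ℝ) < 1 / 4 by norm_num)
  refine ⟨D * D', fun u t hu ht => ?_⟩
  have hm : 0 < max (u / t) (t / u) := lt_max_of_lt_left (by positivity)
  have := chi0_le_dilate (r := r) (q := q) (l := t / u) (by finiteness) (by finiteness)
    (by positivity) hu (hD.le_dilate hu ht) (hD'.le_dilate hu ht)
  rw [div_mul_cancel₀ _ hu.ne'] at this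
  refine this.trans_eq ?_
  rw [show (1 / 2 : ℝ) = 1 / 4 + 1 / 4 by norm_num, Real.rpow_add hm,
    ENNReal.ofReal_mul (by positivity), ENNReal.coe_mul]
  ring

lemma exists_powerBounded_chi1 (ha : IsSlowlyVarying a) (hb : IsSlowlyVarying b) :
    ∃ D, PowerBounded D (1 / 2) (chi1 r b q a) := by
  obtain ⟨D, hD⟩ := ha.exists_powerBounded (show (0 : ℝ) < 1 / 4 by norm_num)
  obtain ⟨D', hD'⟩ := hb.exists_powerBounded (show (0 : ℝ) < 1 / 4 by norm_num)
  refine ⟨D * D', fun u t hu ht => ?_⟩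
  have hm : 0 < max (u / t) (t / u) := lt_max_of_lt_left (by positivity)
  have := chi1_le_dilate (r := r) (q := q) (l := t / u) (by finiteness) (by finiteness)
    (by positivity) hu (hD.le_dilate hu ht) (hD'.le_dilate hu ht)
  rw [div_mul_cancel₀ _ hu.ne'] at this
  refine this.trans_eq ?_
  rw [show (1 / 2 : ℝ) = 1 / 4 + 1 / 4 by norm_num, Real.rpow_add hm,
    ENNReal.ofReal_mul (by positivity), ENNReal.coe_mul]
  ring

lemma PowerBounded.lt_top {D : ℝ≥0} {η : ℝ} {ψ : ℝ → ℝ≥0∞} (h : PowerBounded D η ψ)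
    (h1 : ψ 1 < ∞) (t : ℝ) (ht : 0 < t) : ψ t < ∞ :=
  (h t 1 ht one_pos).trans_lt (ENNReal.mul_lt_top (by finiteness) h1)

/-- For `s > 2 t` the inner norm in `χ₀ t` is at least the one over `(t, 2 t)`. -/
lemma wNorm_Ioi_mul_le_chi0 {t : ℝ} (ht : 0 < t) : wNorm 0 r b (Ioi (t * 2)) (fun _ => 1) *
    wNorm 0 q a (Ioo t (t * 2)) (fun _ => 1) ≤ chi0 r b q a t := by
  rw [mul_comm]
  refine (const_mul_wNorm_le (F := fun s => wNorm 0 q a (Ioo t s) fun _ => 1) measurableSet_Ioi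
    fun s hs => ?_).trans (wNorm_mono_set (Ioi_subset_Ioi (by linarith)))
  rw [mul_one]
  exact wNorm_mono_set (Ioo_subset_Ioo_right (le_of_lt hs))

lemma exists_mul_le_chi0 (hq : 0 < q) (hr : 0 < r) (ha : IsSlowlyVarying a)
    (hb : IsSlowlyVarying b) : ∃ C : ℝ≥0, ∀ t : ℝ, 0 < t →
      ENNReal.ofReal (b t) * ENNReal.ofReal (a t) ≤ C * chi0 r b q a t := by
  obtain ⟨A, hA⟩ := ha.exists_le_wNorm hq one_pos one_lt_two
  obtain ⟨B, hB⟩ := hb.exists_le_wNorm hr two_pos (show (2 : ℝ) < 3 by norm_num)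
  refine ⟨B * A, fun t ht => ?_⟩
  have h1 := hA t ht
  rw [mul_one] at h1
  calc _ ≤ (B * wNorm 0 r b (Ioi (t * 2)) (fun _ => 1)) *
        (A * wNorm 0 q a (Ioo t (t * 2)) (fun _ => 1)) :=
        mul_le_mul' ((hB t ht).trans (mul_le_mul_right (wNorm_mono_set Ioo_subset_Ioi_self) _)) h1
    _ = B * A * (wNorm 0 r b (Ioi (t * 2)) (fun _ => 1) *
        wNorm 0 q a (Ioo t (t * 2)) (fun _ => 1)) := by ring
    _ ≤ _ := by rw [ENNReal.coe_mul]; exact mul_le_mul_right (wNorm_Ioi_mul_le_chi0 ht) _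

/-- Split `(t, ∞)` into `(t, 3 t)`, where the norm of `b` is comparable to `b t`, and `(2 t, ∞)`. -/
lemma exists_wNorm_Ioi_mul_le_chi0 (hq : 0 < q) (hr : 0 < r) (ha : IsSlowlyVarying a)
    (hb : IsSlowlyVarying b) : ∃ C : ℝ≥0, ∀ t : ℝ, 0 < t →
      wNorm 0 r b (Ioi t) (fun _ => 1) * ENNReal.ofReal (a t) ≤ C * chi0 r b q a t := by
  obtain ⟨A, hA⟩ := ha.exists_le_wNorm hq one_pos one_lt_two
  obtain ⟨B, hB⟩ := hb.exists_wNorm_le hr one_pos (show (1 : ℝ) < 3 by norm_num)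
  obtain ⟨C, hC⟩ := exists_mul_le_chi0 hq hr ha hb
  obtain ⟨L, hL⟩ : ∃ L : ℝ≥0, (L : ℝ≥0∞) = ENNReal.LpAddConst r :=
    ⟨_, ENNReal.coe_toNNReal (ENNReal.LpAddConst_lt_top r).ne⟩
  refine ⟨L * (B * C + A), fun t ht => ?_⟩
  have h1 := hA t ht
  rw [mul_one] at h1
  have h2 : wNorm 0 r b (Ioi t) (fun _ => 1) ≤ L * (wNorm 0 r b (Ioo (t * 1) (t * 3)) (fun _ => 1) +
      wNorm 0 r b (Ioi (t * 2)) (fun _ => 1)) := by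
    rw [hL]
    refine (wNorm_mono_set fun x hx => ?_).trans (wNorm_union_le hb.measurable measurableSet_Ioo
      measurableSet_Ioi (fun x hx => (by positivity : 0 < t * 1).trans hx.1)
      (fun x hx => (by positivity : 0 < t * 2).trans hx) measurable_const)
    simp only [mem_union, mem_Ioo, mem_Ioi] at hx ⊢
    rcases lt_or_ge x (t * 3) with h | h
    · exact .inl ⟨by linarith, h⟩
    · exact .inr (by linarith)
  calc _ ≤ L * (B * ENNReal.ofReal (b t) + wNorm 0 r b (Ioi (t * 2)) (fun _ => 1)) *
        ENNReal.ofReal (a t) := by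
        gcongr
        exact h2.trans (by gcongr; exact hB t ht)
    _ = L * (B * (ENNReal.ofReal (b t) * ENNReal.ofReal (a t)) +
        wNorm 0 r b (Ioi (t * 2)) (fun _ => 1) * ENNReal.ofReal (a t)) := by ring
    _ ≤ L * (B * (C * chi0 r b q a t) + wNorm 0 r b (Ioi (t * 2)) (fun _ => 1) *
        (A * wNorm 0 q a (Ioo t (t * 2)) (fun _ => 1))) := by
        exact mul_le_mul_right (add_le_add (mul_le_mul_right (hC t ht) _)
          (mul_le_mul_right h1 _)) _
    _ = L * (B * (C * chi0 r b q a t) + A * (wNorm 0 r b (Ioi (t * 2)) (fun _ => 1) *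
        wNorm 0 q a (Ioo t (t * 2)) (fun _ => 1))) := by ring
    _ ≤ L * (B * (C * chi0 r b q a t) + A * chi0 r b q a t) := by
        gcongr
        exact wNorm_Ioi_mul_le_chi0 ht
    _ = _ := by push_cast; ring

lemma exists_wNorm_Ioi_mul_le_chi1 (hq : 0 < q) (ha : IsSlowlyVarying a) :
    ∃ C : ℝ≥0, ∀ t : ℝ, 0 < t →
      wNorm 0 r b (Ioi t) (fun _ => 1) * ENNReal.ofReal (a t) ≤ C * chi1 r b q a t := by
  obtain ⟨A, hA⟩ := ha.exists_le_wNorm hq one_half_pos (one_half_lt_one (α := ℝ))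
  refine ⟨A, fun t ht => ?_⟩
  have h1 := hA t ht
  rw [mul_one] at h1
  calc _ ≤ wNorm 0 r b (Ioi t) (fun _ => 1) * (A * wNorm 0 q a (Ioo 0 t) (fun _ => 1)) :=
        mul_le_mul_right (h1.trans (mul_le_mul_right
          (wNorm_mono_set (Ioo_subset_Ioo_left (by positivity))) _)) _
    _ = A * (wNorm 0 r b (Ioi t) (fun _ => 1) * wNorm 0 q a (Ioo 0 t) (fun _ => 1)) := by ring
    _ ≤ _ := mul_le_mul_right le_add_self _

lemma wNorm_Ioi_one_pos (hr : 0 < r) (hb : IsSlowlyVarying b) {t : ℝ} (ht : 0 < t) :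
    0 < wNorm 0 r b (Ioi t) fun _ => 1 :=
  (wNorm_one_pos hr hb ht.le (lt_add_one t)).trans_le (wNorm_mono_set Ioo_subset_Ioi_self)

lemma chi0_pos (hq : 0 < q) (hr : 0 < r) (ha : IsSlowlyVarying a) (hb : IsSlowlyVarying b) {t : ℝ}
    (ht : 0 < t) : 0 < chi0 r b q a t :=
  (ENNReal.mul_pos (wNorm_Ioi_one_pos hr hb (by positivity)).ne'
    (wNorm_one_pos hq ha ht.le (by linarith)).ne').trans_le (wNorm_Ioi_mul_le_chi0 ht)

lemma chi1_pos (hq : 0 < q) (hr : 0 < r) (ha : IsSlowlyVarying a) (hb : IsSlowlyVarying b) {t : ℝ}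
    (ht : 0 < t) : 0 < chi1 r b q a t :=
  (ENNReal.mul_pos (wNorm_Ioi_one_pos hr hb ht).ne'
    (wNorm_one_pos hq ha le_rfl ht).ne').trans_le le_add_self

lemma chi0_lt_top (ha : IsSlowlyVarying a) (hb : IsSlowlyVarying b)
    (h : wNorm 0 r b (Ioi 1) (fun s => wNorm 0 q a (Ioo 1 s) fun _ => 1) < ∞) {t : ℝ}
    (ht : 0 < t) : chi0 r b q a t < ∞ := by
  obtain ⟨D, hD⟩ := exists_powerBounded_chi0 (r := r) (q := q) ha hb
  exact hD.lt_top h t ht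

lemma chi1_lt_top (hr : 0 < r) (ha : IsSlowlyVarying a) (hb : IsSlowlyVarying b)
    (h : wNorm 0 r b (Ioi 1) (fun _ => 1) < ∞)
    (h' : wNorm 0 r b (Ioo 0 1) (fun s => wNorm 0 q a (Ioo 0 s) fun _ => 1) < ∞) {t : ℝ}
    (ht : 0 < t) : chi1 r b q a t < ∞ := by
  obtain ⟨D, hD⟩ := exists_powerBounded_chi1 (r := r) (q := q) ha hb
  refine hD.lt_top (ENNReal.add_lt_top.2 ⟨h', ENNReal.mul_lt_top h ?_⟩) t ht
  -- The hypothesis on `(0, 1)` controls the inner norm over `(0, 1/2)`; dilate to `(0, 1)`.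
  have h1 : wNorm 0 q a (Ioo 0 (1 / 2)) (fun _ => 1) < ∞ := by
    have h2 : wNorm 0 q a (Ioo 0 (1 / 2)) (fun _ => 1) *
        wNorm 0 r b (Ioo (1 / 2) 1) (fun _ => 1) < ∞ := by
      refine lt_of_le_of_lt ((const_mul_wNorm_le
        (F := fun s => wNorm 0 q a (Ioo 0 s) fun _ => 1) measurableSet_Ioo fun s hs => ?_).trans
        (wNorm_mono_set (Ioo_subset_Ioo_left (by norm_num)))) h'
      rw [mul_one]
      exact wNorm_mono_set (Ioo_subset_Ioo_right hs.1.le)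
    have h3 := (wNorm_one_pos (α := 0) hr hb one_half_pos.le (one_half_lt_one (α := ℝ))).ne'
    by_contra h4
    rw [not_lt, top_le_iff] at h4
    rw [h4, ENNReal.top_mul h3] at h2
    exact lt_irrefl _ h2
  obtain ⟨C, hC⟩ := ha.exists_powerBounded one_pos
  have h5 := wNorm_dilate_Ioo_le (q := q) (F := fun _ => 1) (c := 0) (d := 1) (by finiteness)
    (by norm_num) (hC.le_dilate two_pos one_pos) le_rfl
  rw [mul_zero, mul_one] at h5
  exact h5.trans_lt (ENNReal.mul_lt_top (by finiteness) h1)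

/-! ### Estimates for quasi-concave functions -/

variable {q₀ r₀ q₁ r₁ : ℝ≥0∞} {a₀ b₀ a₁ b₁ : ℝ → ℝ}

/-- The two growth properties of `t ↦ K(t, f)` that the estimates use: `F` is increasing and
`t⁻¹ F(t)` is decreasing on `(0, ∞)`. -/
structure QuasiConcave (F : ℝ → ℝ≥0∞) : Prop where
  mono : Monotone F
  mul_le : ∀ u t : ℝ, 0 < u → u ≤ t → ENNReal.ofReal u * F t ≤ ENNReal.ofReal t * F u

/-- The norm `‖s ^ (-1/r) b(s) ‖u ^ (α - 1/q) a(u) F(u)‖_{q, (0, s)}‖_{r, (0, ∞)}`. -/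
def nestedNorm (α : ℝ) (r : ℝ≥0∞) (b : ℝ → ℝ) (q : ℝ≥0∞) (a : ℝ → ℝ) (F : ℝ → ℝ≥0∞) : ℝ≥0∞ :=
  wNorm 0 r b (Ioi 0) fun s => wNorm α q a (Ioo 0 s) F

/-- The right-hand side of the formula for the `K`-functional, for an arbitrary function `F` in
place of `K(·, f)` and an arbitrary factor `ρ`. -/
def holmstedtSum (r₀ : ℝ≥0∞) (b₀ : ℝ → ℝ) (q₀ : ℝ≥0∞) (a₀ : ℝ → ℝ) (r₁ : ℝ≥0∞) (b₁ : ℝ → ℝ)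
    (q₁ : ℝ≥0∞) (a₁ : ℝ → ℝ) (ρ : ℝ≥0∞) (F : ℝ → ℝ≥0∞) (t : ℝ) : ℝ≥0∞ :=
  wNorm 0 r₀ b₀ (Ioo 0 t) (fun s => wNorm 0 q₀ a₀ (Ioo 0 s) F)
    + wNorm 0 r₀ b₀ (Ioi t) (fun _ => 1) * wNorm 0 q₀ a₀ (Ioo 0 t) F
    + ρ * wNorm 0 r₁ b₁ (Ioi t) (fun s => wNorm (-1) q₁ a₁ (Ioo t s) F)
    + chi0 r₀ b₀ q₀ a₀ t * F t

lemma nestedNorm_Ioo_le {t : ℝ} :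
    wNorm 0 r b (Ioo 0 t) (fun s => wNorm α q a (Ioo 0 s) F) ≤ nestedNorm α r b q a F :=
  wNorm_mono_set Ioo_subset_Ioi_self

lemma wNorm_Ioi_mul_le_nestedNorm {t : ℝ} (ht : 0 ≤ t) :
    wNorm 0 r b (Ioi t) (fun _ => 1) * wNorm α q a (Ioo 0 t) F ≤ nestedNorm α r b q a F := by
  rw [mul_comm]
  refine (const_mul_wNorm_le (F := fun s => wNorm α q a (Ioo 0 s) F) measurableSet_Ioi
    fun s hs => ?_).trans (wNorm_mono_set (Ioi_subset_Ioi ht))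
  rw [mul_one]
  exact wNorm_mono_set (Ioo_subset_Ioo_right (le_of_lt hs))

lemma wNorm_Ioi_Ioo_le_nestedNorm {t : ℝ} (ht : 0 ≤ t) :
    wNorm 0 r b (Ioi t) (fun s => wNorm α q a (Ioo t s) F) ≤ nestedNorm α r b q a F :=
  (wNorm_mono measurableSet_Ioi fun _ _ => wNorm_mono_set (Ioo_subset_Ioo_left ht)).trans
    (wNorm_mono_set (Ioi_subset_Ioi ht))

lemma QuasiConcave.chi0_mul_le (hF : QuasiConcave F) {t : ℝ} (ht : 0 ≤ t) :
    chi0 r b q a t * F t ≤ nestedNorm 0 r b q a F := by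
  rw [mul_comm]
  refine le_trans ?_ (wNorm_Ioi_Ioo_le_nestedNorm ht)
  refine const_mul_wNorm_le measurableSet_Ioi fun s _ => ?_
  refine const_mul_wNorm_le measurableSet_Ioo fun u hu => ?_
  rw [mul_one]
  exact hF.mono hu.1.le

lemma QuasiConcave.mul_wNorm_Ioo_le (hF : QuasiConcave F) {t s : ℝ} (hst : s ≤ t) :
    F t * wNorm 0 q a (Ioo 0 s) (fun _ => 1) ≤
      ENNReal.ofReal t * wNorm (-1) q a (Ioo 0 s) F := by
  have h := wNorm_rpow_mul (-1) 1 q a (measurableSet_Ioo (a := (0 : ℝ)) (b := s))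
    (fun x hx => hx.1) (fun _ => 1)
  rw [neg_add_cancel] at h
  rw [← h]
  refine (const_mul_wNorm_le (F := fun u => ENNReal.ofReal t * F u) measurableSet_Ioo
    fun u hu => ?_).trans (wNorm_le_mul measurableSet_Ioo ENNReal.ofReal_ne_top fun _ _ => le_rfl)
  rw [mul_one, Real.rpow_one, mul_comm]
  exact hF.mul_le u t hu.1 (hu.2.le.trans hst)

/-- On `(0, t)` one has `u⁻¹ F(u) ≥ t⁻¹ F(t)`; the two summands of `χ₁` come from `s < t` and from
`s > t` in the outer norm. -/
lemma QuasiConcave.chi1_mul_le (hF : QuasiConcave F) {t : ℝ} (ht : 0 < t) :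
    chi1 r b q a t * F t ≤ 2 * (ENNReal.ofReal t * nestedNorm (-1) r b q a F) := by
  have h1 : F t * wNorm 0 r b (Ioo 0 t) (fun s => wNorm 0 q a (Ioo 0 s) fun _ => 1) ≤
      ENNReal.ofReal t * wNorm 0 r b (Ioo 0 t) (fun s => wNorm (-1) q a (Ioo 0 s) F) :=
    (const_mul_wNorm_le (F := fun s => ENNReal.ofReal t * wNorm (-1) q a (Ioo 0 s) F)
      measurableSet_Ioo fun s hs => hF.mul_wNorm_Ioo_le hs.2.le).trans
      (wNorm_le_mul measurableSet_Ioo ENNReal.ofReal_ne_top fun _ _ => le_rfl)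
  rw [chi1, two_mul, add_mul]
  refine add_le_add ?_ ?_
  · rw [mul_comm]
    exact h1.trans (mul_le_mul_right nestedNorm_Ioo_le _)
  · calc _ = wNorm 0 r b (Ioi t) (fun _ => 1) * (F t * wNorm 0 q a (Ioo 0 t) (fun _ => 1)) := by
          ring
      _ ≤ wNorm 0 r b (Ioi t) (fun _ => 1) *
          (ENNReal.ofReal t * wNorm (-1) q a (Ioo 0 t) F) :=
          mul_le_mul_right (hF.mul_wNorm_Ioo_le le_rfl) _
      _ = ENNReal.ofReal t *
          (wNorm 0 r b (Ioi t) (fun _ => 1) * wNorm (-1) q a (Ioo 0 t) F) := by ring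
      _ ≤ _ := mul_le_mul_right (wNorm_Ioi_mul_le_nestedNorm ht.le) _

/-- The sum for `F` is bounded by the norm of the first space: the only term not contained in that
norm is the third one, where `F ≤ ‖F‖ / χ₀`. -/
lemma exists_holmstedtSum_le_left (hq₀ : 0 < q₀) (hr₀ : 0 < r₀) (hq₁ : 0 < q₁)
    (ha₀ : IsSlowlyVarying a₀) (hb₀ : IsSlowlyVarying b₀) (ha₁ : IsSlowlyVarying a₁)
    (hχ₀ : ∀ t, 0 < t → chi0 r₀ b₀ q₀ a₀ t < ∞) :
    ∃ C : ℝ≥0, ∀ F t, QuasiConcave F → 0 < t →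
      holmstedtSum r₀ b₀ q₀ a₀ r₁ b₁ q₁ a₁
        (ENNReal.ofReal t * chi0 r₀ b₀ q₀ a₀ t * (chi1 r₁ b₁ q₁ a₁ t)⁻¹) F t ≤
        C * nestedNorm 0 r₀ b₀ q₀ a₀ F := by
  obtain ⟨D, hD⟩ := exists_powerBounded_chi0 (r := r₀) (q := q₀) ha₀ hb₀
  have h0 : ∀ t, 0 < t → chi0 r₀ b₀ q₀ a₀ t ≠ 0 := fun t ht => (chi0_pos hq₀ hr₀ ha₀ hb₀ ht).ne'
  obtain ⟨M, hM⟩ := (hD.inv h0 fun t ht => (hχ₀ t ht).ne).exists_wNorm_Ioo_le_left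
    (by norm_num) (fun t ht => ENNReal.inv_ne_top.2 (h0 t ht)) ha₁ hq₁
  obtain ⟨M', hM'⟩ := exists_wNorm_Ioi_mul_le_chi1 (r := r₁) (b := b₁) hq₁ ha₁
  refine ⟨3 + M * M', fun F t hF ht => ?_⟩
  set N := nestedNorm 0 r₀ b₀ q₀ a₀ F with hN
  rcases eq_or_ne N ∞ with hNtop | hNtop
  · rw [hNtop, ENNReal.mul_top (by norm_cast; positivity)]
    exact le_top
  have hFu : ∀ u, 0 < u → F u ≤ N * (chi0 r₀ b₀ q₀ a₀ u)⁻¹ := fun u hu => by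
    rw [← div_eq_mul_inv, ENNReal.le_div_iff_mul_le (.inl (h0 u hu)) (.inl (hχ₀ u hu).ne), mul_comm]
    exact hF.chi0_mul_le hu.le
  have h3 : wNorm 0 r₁ b₁ (Ioi t) (fun s => wNorm (-1) q₁ a₁ (Ioo t s) F) ≤
      N * (M * ENNReal.ofReal t⁻¹ * ENNReal.ofReal (a₁ t) * (chi0 r₀ b₀ q₀ a₀ t)⁻¹) *
        wNorm 0 r₁ b₁ (Ioi t) (fun _ => 1) := by
    refine wNorm_le_mul measurableSet_Ioi ?_ fun s _ => ?_
    · have := h0 t ht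
      finiteness
    · rw [mul_one]
      exact (wNorm_le_mul measurableSet_Ioo hNtop fun u hu => hFu u (ht.trans hu.1)).trans
        (mul_le_mul_right (hM t s ht) _)
  have h3' : ENNReal.ofReal t * chi0 r₀ b₀ q₀ a₀ t * (chi1 r₁ b₁ q₁ a₁ t)⁻¹ *
      wNorm 0 r₁ b₁ (Ioi t) (fun s => wNorm (-1) q₁ a₁ (Ioo t s) F) ≤ M * M' * N := by
    calc _ ≤ ENNReal.ofReal t * chi0 r₀ b₀ q₀ a₀ t * (chi1 r₁ b₁ q₁ a₁ t)⁻¹ *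
          (N * (M * ENNReal.ofReal t⁻¹ * ENNReal.ofReal (a₁ t) * (chi0 r₀ b₀ q₀ a₀ t)⁻¹) *
            wNorm 0 r₁ b₁ (Ioi t) (fun _ => 1)) := mul_le_mul_right h3 _
      _ = (ENNReal.ofReal t * ENNReal.ofReal t⁻¹) *
          (chi0 r₀ b₀ q₀ a₀ t * (chi0 r₀ b₀ q₀ a₀ t)⁻¹) * (chi1 r₁ b₁ q₁ a₁ t)⁻¹ * N * M *
          (wNorm 0 r₁ b₁ (Ioi t) (fun _ => 1) * ENNReal.ofReal (a₁ t)) := by ring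
      _ ≤ 1 * 1 * (chi1 r₁ b₁ q₁ a₁ t)⁻¹ * N * M * (M' * chi1 r₁ b₁ q₁ a₁ t) := by
          refine mul_le_mul' ?_ (hM' t ht)
          gcongr
          · rw [← ENNReal.ofReal_mul ht.le, mul_inv_cancel₀ ht.ne', ENNReal.ofReal_one]
          · exact ENNReal.mul_inv_le_one _
      _ = M * M' * N * (chi1 r₁ b₁ q₁ a₁ t * (chi1 r₁ b₁ q₁ a₁ t)⁻¹) := by ring
      _ ≤ _ := mul_le_of_le_one_right' (ENNReal.mul_inv_le_one _)
  calc _ ≤ N + N + M * M' * N + N :=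
        add_le_add (add_le_add (add_le_add nestedNorm_Ioo_le (wNorm_Ioi_mul_le_nestedNorm ht.le))
          h3') (hF.chi0_mul_le ht.le)
    _ = _ := by push_cast; ring

/-- The sum for `F` is bounded by `ρ` times the norm of the second space. The first two terms are
not contained in that norm; there `F(u) ≤ 2 u ‖F‖ / χ₁(u)`. -/
lemma exists_holmstedtSum_le_right (hq₀ : 0 < q₀) (hr₀ : 0 < r₀) (hq₁ : 0 < q₁) (hr₁ : 0 < r₁)
    (ha₀ : IsSlowlyVarying a₀) (hb₀ : IsSlowlyVarying b₀) (ha₁ : IsSlowlyVarying a₁)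
    (hb₁ : IsSlowlyVarying b₁)
    (hχ₁ : ∀ t, 0 < t → chi1 r₁ b₁ q₁ a₁ t < ∞) :
    ∃ C : ℝ≥0, ∀ F t, QuasiConcave F → 0 < t →
      holmstedtSum r₀ b₀ q₀ a₀ r₁ b₁ q₁ a₁
        (ENNReal.ofReal t * chi0 r₀ b₀ q₀ a₀ t * (chi1 r₁ b₁ q₁ a₁ t)⁻¹) F t ≤
        C * (ENNReal.ofReal t * chi0 r₀ b₀ q₀ a₀ t * (chi1 r₁ b₁ q₁ a₁ t)⁻¹ *
          nestedNorm (-1) r₁ b₁ q₁ a₁ F) := by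
  obtain ⟨D, hD⟩ := exists_powerBounded_chi1 (r := r₁) (q := q₁) ha₁ hb₁
  have h0 : ∀ t, 0 < t → chi1 r₁ b₁ q₁ a₁ t ≠ 0 := fun t ht => (chi1_pos hq₁ hr₁ ha₁ hb₁ ht).ne'
  have hψ := hD.inv h0 fun t ht => (hχ₁ t ht).ne
  have hψtop : ∀ t, 0 < t → (chi1 r₁ b₁ q₁ a₁ t)⁻¹ ≠ ∞ := fun t ht =>
    ENNReal.inv_ne_top.2 (h0 t ht)
  obtain ⟨M, hM⟩ := hψ.exists_wNorm_Ioo_le_right (by norm_num) hψtop ha₀ hq₀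
  -- The outer norm is estimated like the inner one, with `a₀ / χ₁` in place of `1 / χ₁`; its
  -- exponent `1/4 + 1/2` is still smaller than one.
  obtain ⟨A, hA⟩ := ha₀.exists_powerBounded (show (0 : ℝ) < 1 / 4 by norm_num)
  obtain ⟨M₂, hM₂⟩ := (hA.mul hψ).exists_wNorm_Ioo_le_right (by norm_num)
    (fun t ht => ENNReal.mul_ne_top ENNReal.ofReal_ne_top (hψtop t ht)) hb₀ hr₀
  obtain ⟨M₃, hM₃⟩ := exists_mul_le_chi0 hq₀ hr₀ ha₀ hb₀
  obtain ⟨M₄, hM₄⟩ := exists_wNorm_Ioi_mul_le_chi0 hq₀ hr₀ ha₀ hb₀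
  refine ⟨2 * M * M₂ * M₃ + 2 * M * M₄ + 3, fun F t hF ht => ?_⟩
  set N := nestedNorm (-1) r₁ b₁ q₁ a₁ F with hN
  set ρ := ENNReal.ofReal t * chi0 r₀ b₀ q₀ a₀ t * (chi1 r₁ b₁ q₁ a₁ t)⁻¹ with hρ
  have hρ0 : ρ ≠ 0 := mul_ne_zero (mul_ne_zero (by simpa using ht)
    (chi0_pos hq₀ hr₀ ha₀ hb₀ ht).ne') (ENNReal.inv_ne_zero.2 (hχ₁ t ht).ne)
  rcases eq_or_ne N ∞ with hNtop | hNtop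
  · rw [hNtop, ENNReal.mul_top hρ0, ENNReal.mul_top (by norm_cast; positivity)]
    exact le_top
  have hFu : ∀ u, 0 < u → F u ≤ 2 * N * (ENNReal.ofReal u * (chi1 r₁ b₁ q₁ a₁ u)⁻¹) :=
    fun u hu => by
      rw [← mul_assoc, ← div_eq_mul_inv, ENNReal.le_div_iff_mul_le (.inl (h0 u hu))
        (.inl (hχ₁ u hu).ne), mul_comm]
      exact (hF.chi1_mul_le hu).trans_eq (by ring)
  have h1 : ∀ s, 0 < s → wNorm 0 q₀ a₀ (Ioo 0 s) F ≤ 2 * N *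
      (M * ENNReal.ofReal s * ENNReal.ofReal (a₀ s) * (chi1 r₁ b₁ q₁ a₁ s)⁻¹) := fun s hs =>
    (wNorm_le_mul measurableSet_Ioo (by finiteness) fun u hu => hFu u hu.1).trans
      (mul_le_mul_right (hM s hs) _)
  have h2 : wNorm 0 r₀ b₀ (Ioo 0 t) (fun s => wNorm 0 q₀ a₀ (Ioo 0 s) F) ≤
      2 * M * M₂ * M₃ * (ρ * N) := by
    calc _ ≤ 2 * N * M * wNorm 0 r₀ b₀ (Ioo 0 t) (fun s => ENNReal.ofReal s *
          (ENNReal.ofReal (a₀ s) * (chi1 r₁ b₁ q₁ a₁ s)⁻¹)) :=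
          wNorm_le_mul measurableSet_Ioo (by finiteness) fun s hs =>
            (h1 s hs.1).trans_eq (by ring)
      _ ≤ 2 * N * M * (M₂ * ENNReal.ofReal t * ENNReal.ofReal (b₀ t) *
          (ENNReal.ofReal (a₀ t) * (chi1 r₁ b₁ q₁ a₁ t)⁻¹)) := mul_le_mul_right (hM₂ t ht) _
      _ = 2 * N * M * (M₂ * ENNReal.ofReal t * (chi1 r₁ b₁ q₁ a₁ t)⁻¹) *
          (ENNReal.ofReal (b₀ t) * ENNReal.ofReal (a₀ t)) := by ring
      _ ≤ 2 * N * M * (M₂ * ENNReal.ofReal t * (chi1 r₁ b₁ q₁ a₁ t)⁻¹) *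
          (M₃ * chi0 r₀ b₀ q₀ a₀ t) := mul_le_mul_right (hM₃ t ht) _
      _ = _ := by rw [hρ]; ring
  have h3 : wNorm 0 r₀ b₀ (Ioi t) (fun _ => 1) * wNorm 0 q₀ a₀ (Ioo 0 t) F ≤
      2 * M * M₄ * (ρ * N) := by
    calc _ ≤ wNorm 0 r₀ b₀ (Ioi t) (fun _ => 1) * (2 * N *
          (M * ENNReal.ofReal t * ENNReal.ofReal (a₀ t) * (chi1 r₁ b₁ q₁ a₁ t)⁻¹)) :=
          mul_le_mul_right (h1 t ht) _
      _ = 2 * N * (M * ENNReal.ofReal t * (chi1 r₁ b₁ q₁ a₁ t)⁻¹) *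
          (wNorm 0 r₀ b₀ (Ioi t) (fun _ => 1) * ENNReal.ofReal (a₀ t)) := by ring
      _ ≤ 2 * N * (M * ENNReal.ofReal t * (chi1 r₁ b₁ q₁ a₁ t)⁻¹) *
          (M₄ * chi0 r₀ b₀ q₀ a₀ t) := mul_le_mul_right (hM₄ t ht) _
      _ = _ := by rw [hρ]; ring
  have h4 : chi0 r₀ b₀ q₀ a₀ t * F t ≤ 2 * (ρ * N) :=
    (mul_le_mul_right (hFu t ht) _).trans_eq (by rw [hρ]; ring)
  calc _ ≤ 2 * M * M₂ * M₃ * (ρ * N) + 2 * M * M₄ * (ρ * N) + ρ * N + 2 * (ρ * N) :=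
        add_le_add (add_le_add (add_le_add h2 h3)
          (mul_le_mul_right (wNorm_Ioi_Ioo_le_nestedNorm ht.le) _)) h4
    _ = _ := by push_cast; ring

lemma wNorm_le_of_le_mul_add {k : ℝ≥0} (ha : AEMeasurable a (volume.restrict (Ioi 0)))
    (hI : MeasurableSet I) (hI0 : I ⊆ Ioi 0) (hG : Measurable G) (hH : Measurable H)
    (h : ∀ x, 0 < x → F x ≤ k * (G x + H x)) :
    wNorm α q a I F ≤ k * ENNReal.LpAddConst q * (wNorm α q a I G + wNorm α q a I H) := by
  rw [mul_assoc]
  exact (wNorm_le_mul hI ENNReal.coe_ne_top fun x hx => h x (hI0 hx)).trans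
    (mul_le_mul_right (wNorm_add_le ha hI0 hG hH) _)

lemma nested_le_of_le_mul_add {k : ℝ≥0} {c : ℝ} (hc : 0 ≤ c)
    (ha : AEMeasurable a (volume.restrict (Ioi 0))) (hb : AEMeasurable b (volume.restrict (Ioi 0)))
    (hI : MeasurableSet I) (hI0 : I ⊆ Ioi 0) (hG : Measurable G) (hH : Measurable H)
    (h : ∀ x, 0 < x → F x ≤ k * (G x + H x)) :
    wNorm 0 r b I (fun s => wNorm α q a (Ioo c s) F) ≤
      k * ENNReal.LpAddConst q * ENNReal.LpAddConst r *
        (wNorm 0 r b I (fun s => wNorm α q a (Ioo c s) G) +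
          wNorm 0 r b I (fun s => wNorm α q a (Ioo c s) H)) := by
  have hq := (ENNReal.LpAddConst_lt_top q).ne
  rw [mul_assoc _ (ENNReal.LpAddConst r)]
  exact (wNorm_le_mul hI (by finiteness) fun s _ => wNorm_le_of_le_mul_add ha measurableSet_Ioo
    (fun x hx => hc.trans_lt hx.1) hG hH h).trans (mul_le_mul_right (wNorm_add_le hb hI0
      (monotone_wNorm_Ioo_right _ _ _ _ _).measurable
      (monotone_wNorm_Ioo_right _ _ _ _ _).measurable) _)

/-- The sum is quasi-subadditive in `F`. -/
lemma exists_holmstedtSum_le_add (ha₀ : IsSlowlyVarying a₀) (hb₀ : IsSlowlyVarying b₀)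
    (ha₁ : IsSlowlyVarying a₁) (hb₁ : IsSlowlyVarying b₁) (k : ℝ≥0) :
    ∃ C : ℝ≥0, ∀ (ρ : ℝ≥0∞) (F G H : ℝ → ℝ≥0∞) (t : ℝ), 0 < t → Monotone G → Monotone H →
      (∀ x, 0 < x → F x ≤ k * (G x + H x)) →
      holmstedtSum r₀ b₀ q₀ a₀ r₁ b₁ q₁ a₁ ρ F t ≤
        C * (holmstedtSum r₀ b₀ q₀ a₀ r₁ b₁ q₁ a₁ ρ G t +
          holmstedtSum r₀ b₀ q₀ a₀ r₁ b₁ q₁ a₁ ρ H t) := by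
  have hL : ∀ q, ∃ L : ℝ≥0, (L : ℝ≥0∞) = ENNReal.LpAddConst q := fun q =>
    ⟨_, ENNReal.coe_toNNReal (ENNReal.LpAddConst_lt_top q).ne⟩
  choose L hL using hL
  refine ⟨k * L q₀ * L r₀ + k * L q₀ + k * L q₁ * L r₁ + k,
    fun ρ F G H t ht hG hH h => ?_⟩
  have h1 := nested_le_of_le_mul_add (α := 0) (r := r₀) (q := q₀) le_rfl ha₀.measurable
    hb₀.measurable (measurableSet_Ioo (a := (0 : ℝ)) (b := t)) (fun x hx => hx.1) hG.measurable
    hH.measurable h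
  have h2 := wNorm_le_of_le_mul_add (α := 0) (q := q₀) ha₀.measurable
    (measurableSet_Ioo (a := (0 : ℝ)) (b := t)) (fun x hx => hx.1) hG.measurable hH.measurable h
  have h3 := nested_le_of_le_mul_add (α := -1) (r := r₁) (q := q₁) ht.le ha₁.measurable
    hb₁.measurable (measurableSet_Ioi (a := t)) (fun x hx => ht.trans hx) hG.measurable
    hH.measurable h
  rw [← hL, ← hL] at h1 h3
  rw [← hL] at h2
  unfold holmstedtSum
  set c := (k : ℝ≥0∞) * L q₀ * L r₀ + k * L q₀ + k * L q₁ * L r₁ + k with hc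
  have hc1 : (k : ℝ≥0∞) * L q₀ * L r₀ ≤ c := by rw [hc, add_assoc, add_assoc]; exact le_self_add
  have hc2 : (k : ℝ≥0∞) * L q₀ ≤ c := by
    rw [hc, add_assoc, add_right_comm]; exact le_add_self
  have hc3 : (k : ℝ≥0∞) * L q₁ * L r₁ ≤ c := by rw [hc, add_right_comm]; exact le_add_self
  have hc4 : (k : ℝ≥0∞) ≤ c := le_add_self
  have h1' := h1.trans (mul_le_mul_left hc1 _)
  have h2' := h2.trans (mul_le_mul_left hc2 _)
  have h3' := h3.trans (mul_le_mul_left hc3 _)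
  have h4' := (h t ht).trans (mul_le_mul_left hc4 _)
  push_cast
  rw [← hc]
  calc _ ≤ _ := add_le_add (add_le_add (add_le_add h1' (mul_le_mul_right h2' _))
        (mul_le_mul_right h3' _)) (mul_le_mul_right h4' _)
    _ = _ := by ring

/-- Splitting the norm at `t`: the outer integral into `(0, t)` and `(t, ∞)`, and for `s > t` the
inner one into `(0, t)` and `(t, s)`. -/
lemma exists_nestedNorm_le (ha : IsSlowlyVarying a) (hb : IsSlowlyVarying b) :
    ∃ C : ℝ≥0, ∀ (F : ℝ → ℝ≥0∞) (t : ℝ), 0 < t → Measurable F →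
      nestedNorm α r b q a F ≤ C * (wNorm 0 r b (Ioo 0 t) (fun s => wNorm α q a (Ioo 0 s) F) +
        wNorm 0 r b (Ioi t) (fun _ => 1) * wNorm α q a (Ioo 0 t) F +
        wNorm 0 r b (Ioi t) (fun s => wNorm α q a (Ioo t s) F)) := by
  have hL : ∀ q, ∃ L : ℝ≥0, (L : ℝ≥0∞) = ENNReal.LpAddConst q := fun q =>
    ⟨_, ENNReal.coe_toNNReal (ENNReal.LpAddConst_lt_top q).ne⟩
  choose L hL using hL
  have hIoc : ∀ {α : ℝ} {q : ℝ≥0∞} {a : ℝ → ℝ} {c d : ℝ} {F : ℝ → ℝ≥0∞},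
      wNorm α q a (Ioc c d) F = wNorm α q a (Ioo c d) F := by
    intros
    rw [wNorm, wNorm, Measure.restrict_congr_set Ioo_ae_eq_Ioc]
  refine ⟨L r * (1 + L q * L r), fun F t ht hF => ?_⟩
  have hin : ∀ s ∈ Ioi t, wNorm α q a (Ioo 0 s) F ≤
      L q * (wNorm α q a (Ioo 0 t) F + wNorm α q a (Ioo t s) F) := by
    intro s hs
    rw [hL, ← hIoc (c := 0) (d := t)]
    refine le_of_eq_of_le ?_ (wNorm_union_le ha.measurable measurableSet_Ioc measurableSet_Ioo
      (fun x hx => hx.1) (fun x hx => ht.trans hx.1) hF)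
    rw [Ioc_union_Ioo_eq_Ioo ht.le hs]
  have h1 : wNorm 0 r b (Ioi t) (fun s => wNorm α q a (Ioo 0 s) F) ≤ L q * (L r *
      (wNorm 0 r b (Ioi t) (fun _ => 1) * wNorm α q a (Ioo 0 t) F +
        wNorm 0 r b (Ioi t) (fun s => wNorm α q a (Ioo t s) F))) := by
    refine (wNorm_le_mul measurableSet_Ioi ENNReal.coe_ne_top hin).trans (mul_le_mul_right ?_ _)
    rw [hL]
    exact (wNorm_add_le hb.measurable (fun x hx => ht.trans hx) measurable_const
      (monotone_wNorm_Ioo_right _ _ _ _ _).measurable).trans (mul_le_mul_right (add_le_add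
        (wNorm_const_le hb.measurable (fun x hx => ht.trans hx) _) le_rfl) _)
  have h2 : nestedNorm α r b q a F ≤ L r *
      (wNorm 0 r b (Ioo 0 t) (fun s => wNorm α q a (Ioo 0 s) F) +
        wNorm 0 r b (Ioi t) (fun s => wNorm α q a (Ioo 0 s) F)) := by
    rw [hL, ← hIoc (c := 0) (d := t)]
    refine le_of_eq_of_le ?_ (wNorm_union_le hb.measurable measurableSet_Ioc measurableSet_Ioi
      (fun x hx => hx.1) (fun x hx => ht.trans hx)
      (monotone_wNorm_Ioo_right _ _ _ _ _).measurable)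
    rw [nestedNorm, Ioc_union_Ioi_eq_Ioi ht.le]
  set A := wNorm 0 r b (Ioo 0 t) (fun s => wNorm α q a (Ioo 0 s) F)
  set B := wNorm 0 r b (Ioi t) (fun _ => 1) * wNorm α q a (Ioo 0 t) F
  set D := wNorm 0 r b (Ioi t) (fun s => wNorm α q a (Ioo t s) F)
  calc _ ≤ _ := h2
    _ ≤ L r * ((A + B + D) + L q * (L r * (A + B + D))) := by
      gcongr
      · rw [add_assoc]; exact le_self_add
      · refine h1.trans ?_
        rw [add_assoc]
        exact mul_le_mul_right (mul_le_mul_right le_add_self _) _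
    _ = _ := by push_cast; ring

/-- The norm in the first space of the part `f₀` of an almost optimal decomposition at `t`. -/
lemma exists_nestedNorm_zero_le (ha : IsSlowlyVarying a) (hb : IsSlowlyVarying b) (m : ℝ≥0) :
    ∃ C : ℝ≥0, ∀ (F F₀ : ℝ → ℝ≥0∞) (t : ℝ), 0 < t → Measurable F₀ → F t ≠ ∞ →
      (∀ u, 0 < u → u < t → F₀ u ≤ m * F u) → (∀ u, t < u → F₀ u ≤ m * F t) →
      nestedNorm 0 r b q a F₀ ≤ C * (wNorm 0 r b (Ioo 0 t) (fun s => wNorm 0 q a (Ioo 0 s) F) +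
        wNorm 0 r b (Ioi t) (fun _ => 1) * wNorm 0 q a (Ioo 0 t) F + chi0 r b q a t * F t) := by
  obtain ⟨C, hC⟩ := exists_nestedNorm_le (α := 0) (r := r) (q := q) ha hb
  refine ⟨C * m, fun F F₀ t ht hF₀ hFt h1 h2 => (hC F₀ t ht hF₀).trans ?_⟩
  have hin : ∀ s, s ≤ t → wNorm 0 q a (Ioo 0 s) F₀ ≤ m * wNorm 0 q a (Ioo 0 s) F := fun s hs =>
    wNorm_le_mul measurableSet_Ioo ENNReal.coe_ne_top fun u hu => h1 u hu.1 (hu.2.trans_le hs)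
  have h3 : wNorm 0 r b (Ioi t) (fun s => wNorm 0 q a (Ioo t s) F₀) ≤
      (m * F t) * chi0 r b q a t := by
    refine wNorm_le_mul measurableSet_Ioi (by finiteness) fun s _ => ?_
    refine wNorm_le_mul measurableSet_Ioo (by finiteness) fun u hu => ?_
    rw [mul_one]
    exact h2 u hu.1
  rw [ENNReal.coe_mul, mul_assoc]
  refine mul_le_mul_right ?_ _
  calc _ ≤ m * wNorm 0 r b (Ioo 0 t) (fun s => wNorm 0 q a (Ioo 0 s) F) +
        wNorm 0 r b (Ioi t) (fun _ => 1) * (m * wNorm 0 q a (Ioo 0 t) F) +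
        (m * F t) * chi0 r b q a t :=
        add_le_add (add_le_add (wNorm_le_mul measurableSet_Ioo ENNReal.coe_ne_top fun s hs =>
          hin s hs.2.le) (mul_le_mul_right (hin t le_rfl) _)) h3
    _ = _ := by ring

/-- The norm in the second space of the part `f₁` of an almost optimal decomposition at `t`. -/
lemma exists_nestedNorm_neg_one_le (ha : IsSlowlyVarying a) (hb : IsSlowlyVarying b) (m : ℝ≥0) :
    ∃ C : ℝ≥0, ∀ (F F₁ : ℝ → ℝ≥0∞) (t : ℝ), 0 < t → Measurable F₁ → F t ≠ ∞ →
      (∀ u, 0 < u → u < t → F₁ u ≤ m * F t * ENNReal.ofReal t⁻¹ * ENNReal.ofReal u) →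
      (∀ u, t < u → F₁ u ≤ m * F u) →
      nestedNorm (-1) r b q a F₁ ≤ C * (ENNReal.ofReal t⁻¹ * chi1 r b q a t * F t +
        wNorm 0 r b (Ioi t) (fun s => wNorm (-1) q a (Ioo t s) F)) := by
  obtain ⟨C, hC⟩ := exists_nestedNorm_le (α := -1) (r := r) (q := q) ha hb
  refine ⟨C * m, fun F F₁ t ht hF₁ hFt h1 h2 => (hC F₁ t ht hF₁).trans ?_⟩
  have hin : ∀ s, s ≤ t → wNorm (-1) q a (Ioo 0 s) F₁ ≤
      m * F t * ENNReal.ofReal t⁻¹ * wNorm 0 q a (Ioo 0 s) (fun _ => 1) := fun s hs => by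
    have h := wNorm_rpow_mul (-1) 1 q a (measurableSet_Ioo (a := (0 : ℝ)) (b := s))
      (fun x hx => hx.1) (fun _ => 1)
    rw [neg_add_cancel] at h
    rw [← h]
    refine wNorm_le_mul measurableSet_Ioo (by finiteness) fun u hu => ?_
    rw [Real.rpow_one, mul_one]
    exact h1 u hu.1 (hu.2.trans_le hs)
  have h3 : wNorm 0 r b (Ioi t) (fun s => wNorm (-1) q a (Ioo t s) F₁) ≤
      m * wNorm 0 r b (Ioi t) (fun s => wNorm (-1) q a (Ioo t s) F) :=
    wNorm_le_mul measurableSet_Ioi (by finiteness) fun s _ =>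
      wNorm_le_mul measurableSet_Ioo (by finiteness) fun u hu => h2 u hu.1
  rw [ENNReal.coe_mul, mul_assoc]
  refine mul_le_mul_right ?_ _
  calc _ ≤ (m * F t * ENNReal.ofReal t⁻¹) *
        wNorm 0 r b (Ioo 0 t) (fun s => wNorm 0 q a (Ioo 0 s) (fun _ => 1)) +
        wNorm 0 r b (Ioi t) (fun _ => 1) *
          ((m * F t * ENNReal.ofReal t⁻¹) * wNorm 0 q a (Ioo 0 t) (fun _ => 1)) +
        m * wNorm 0 r b (Ioi t) (fun s => wNorm (-1) q a (Ioo t s) F) :=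
        add_le_add (add_le_add (wNorm_le_mul measurableSet_Ioo (by finiteness) fun s hs =>
          hin s hs.2.le) (mul_le_mul_right (hin t le_rfl) _)) h3
    _ = _ := by rw [chi1]; ring

/-! ### The `K`-functional -/

section KFunctional

variable {𝕜 : Type*} [RCLike 𝕜] {E : Type*} [AddCommGroup E] {N₀ N₁ : E → ℝ≥0∞} {κ : ℝ≥0}

lemma KFunctional_le (N₀ N₁ : E → ℝ≥0∞) (t : ℝ) (f₀ f₁ : E) :
    KFunctional N₀ N₁ t (f₀ + f₁) ≤ N₀ f₀ + ENNReal.ofReal t * N₁ f₁ :=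
  iInf_le_of_le f₀ (iInf_le_of_le f₁ (iInf_le_of_le rfl le_rfl))

lemma exists_of_KFunctional_lt {t : ℝ} {f : E} {c : ℝ≥0∞} (h : KFunctional N₀ N₁ t f < c) :
    ∃ f₀ f₁, f = f₀ + f₁ ∧ N₀ f₀ + ENNReal.ofReal t * N₁ f₁ < c := by
  simpa only [KFunctional, iInf_lt_iff, exists_prop] using h

lemma le_KFunctional {t : ℝ} {f : E} {c : ℝ≥0∞}
    (h : ∀ f₀ f₁, f = f₀ + f₁ → c ≤ N₀ f₀ + ENNReal.ofReal t * N₁ f₁) :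
    c ≤ KFunctional N₀ N₁ t f :=
  le_iInf fun f₀ => le_iInf fun f₁ => le_iInf fun hf => h f₀ f₁ hf

lemma quasiConcave_KFunctional (N₀ N₁ : E → ℝ≥0∞) (f : E) :
    QuasiConcave fun t => KFunctional N₀ N₁ t f where
  mono s t hst := le_KFunctional fun f₀ f₁ hf => by
    subst hf
    refine (KFunctional_le N₀ N₁ s f₀ f₁).trans ?_
    gcongr
  mul_le u t hu hut := by
    have ht := hu.trans_le hut
    have hu' : ENNReal.ofReal u ≠ 0 := by simpa using hu
    have ht' : ENNReal.ofReal t ≠ 0 := by simpa using ht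
    rw [mul_comm (ENNReal.ofReal t), ← ENNReal.div_le_iff ht' ENNReal.ofReal_ne_top]
    refine le_KFunctional fun f₀ f₁ hf => ?_
    rw [ENNReal.div_le_iff ht' ENNReal.ofReal_ne_top]
    subst hf
    calc _ ≤ ENNReal.ofReal u * (N₀ f₀ + ENNReal.ofReal t * N₁ f₁) :=
          mul_le_mul_right (KFunctional_le N₀ N₁ t f₀ f₁) _
      _ = ENNReal.ofReal u * N₀ f₀ + ENNReal.ofReal u * ENNReal.ofReal t * N₁ f₁ := by ring
      _ ≤ ENNReal.ofReal t * N₀ f₀ + ENNReal.ofReal u * ENNReal.ofReal t * N₁ f₁ := by gcongr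
      _ = _ := by ring

lemma KFunctional_add_le (h₀ : ∀ x y, N₀ (x + y) ≤ κ * (N₀ x + N₀ y))
    (h₁ : ∀ x y, N₁ (x + y) ≤ κ * (N₁ x + N₁ y)) (t : ℝ) (f g : E) :
    KFunctional N₀ N₁ t (f + g) ≤ κ * (KFunctional N₀ N₁ t f + KFunctional N₀ N₁ t g) := by
  refine ENNReal.le_of_forall_pos_le_add fun ε hε hfin => ?_
  -- For `κ = 0` the quasi-norms vanish identically.
  rcases eq_or_ne κ 0 with rfl | hκ
  · have h0 := KFunctional_le N₀ N₁ t (f + g) 0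
    have h2 := h₀ f g
    have h3 := h₁ 0 0
    simp only [ENNReal.coe_zero, zero_mul, nonpos_iff_eq_zero, add_zero] at h2 h3
    rw [h2, h3, add_zero] at h0
    exact h0.trans (by simp)
  have hκ' : (κ : ℝ≥0∞) ≠ 0 := by simpa using hκ
  have hKfin : KFunctional N₀ N₁ t f + KFunctional N₀ N₁ t g ≠ ∞ := fun h => by
    rw [h, ENNReal.mul_top hκ'] at hfin
    exact lt_irrefl _ hfin
  rw [ENNReal.add_ne_top] at hKfin
  set δ : ℝ≥0 := ε / (2 * κ) with hδ
  have hδ0 : 0 < δ := by positivity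
  obtain ⟨f₀, f₁, rfl, hf⟩ := exists_of_KFunctional_lt
    (ENNReal.lt_add_right hKfin.1 (ENNReal.coe_ne_zero.2 hδ0.ne'))
  obtain ⟨g₀, g₁, rfl, hg⟩ := exists_of_KFunctional_lt
    (ENNReal.lt_add_right hKfin.2 (ENNReal.coe_ne_zero.2 hδ0.ne'))
  have hk : κ * (δ + δ) = ε := by rw [hδ]; field_simp; ring
  calc _ = KFunctional N₀ N₁ t ((f₀ + g₀) + (f₁ + g₁)) := by rw [add_add_add_comm]
    _ ≤ N₀ (f₀ + g₀) + ENNReal.ofReal t * N₁ (f₁ + g₁) := KFunctional_le _ _ _ _ _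
    _ ≤ κ * (N₀ f₀ + N₀ g₀) + ENNReal.ofReal t * (κ * (N₁ f₁ + N₁ g₁)) := by
      gcongr
      exacts [h₀ _ _, h₁ _ _]
    _ = κ * ((N₀ f₀ + ENNReal.ofReal t * N₁ f₁) + (N₀ g₀ + ENNReal.ofReal t * N₁ g₁)) := by ring
    _ ≤ κ * ((KFunctional N₀ N₁ t (f₀ + f₁) + δ) + (KFunctional N₀ N₁ t (g₀ + g₁) + δ)) := by
      gcongr
    _ = κ * (KFunctional N₀ N₁ t (f₀ + f₁) + KFunctional N₀ N₁ t (g₀ + g₁)) +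
        ((κ * (δ + δ) : ℝ≥0) : ℝ≥0∞) := by push_cast; ring
    _ = _ := by rw [hk]

variable [Module 𝕜 E] [TopologicalSpace E]

lemma IsQuasiBanachIn.map_zero (h : IsQuasiBanachIn 𝕜 κ N₀) : N₀ 0 = 0 := by
  simpa using h.smul 0 0

lemma IsQuasiBanachIn.map_neg (h : IsQuasiBanachIn 𝕜 κ N₀) (x : E) : N₀ (-x) = N₀ x := by
  simpa using h.smul (-1) x

/-- Only the zero vector has vanishing `K`-functional, because the ambient space is Hausdorff. -/
lemma eq_zero_of_KFunctional_eq_zero [IsTopologicalAddGroup E] [T2Space E]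
    (h₀ : IsQuasiBanachIn 𝕜 κ N₀) (h₁ : IsQuasiBanachIn 𝕜 κ N₁) {t : ℝ} (ht : 0 < t) {f : E}
    (hf : KFunctional N₀ N₁ t f = 0) : f = 0 := by
  have ht' : ENNReal.ofReal t ≠ 0 := by simpa using ht
  by_contra hne
  have hU : {f}ᶜ ∈ 𝓝 (0 : E) := isOpen_compl_singleton.mem_nhds (by simpa using Ne.symm hne)
  obtain ⟨V, hV, hVU⟩ := exists_nhds_zero_half hU
  obtain ⟨ε, hε, hεV⟩ := h₀.embedding V hV
  obtain ⟨δ, hδ, hδV⟩ := h₁.embedding V hV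
  have hpos : 0 < min ε (ENNReal.ofReal t * δ) := lt_min hε (ENNReal.mul_pos ht' hδ.ne')
  rw [← hf] at hpos
  obtain ⟨f₀, f₁, hfe, hlt⟩ := exists_of_KFunctional_lt hpos
  have hl := lt_min_iff.1 hlt
  have e0 : f₀ ∈ V := hεV f₀ (lt_of_le_of_lt le_self_add hl.1)
  have e1 : f₁ ∈ V := hδV f₁
    ((ENNReal.mul_lt_mul_iff_right ht' ENNReal.ofReal_ne_top).1 (lt_of_le_of_lt le_add_self hl.2))
  exact hVU f₀ e0 f₁ e1 (by simp [hfe])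

/-- An almost optimal decomposition for the `K`-functional at `t`. -/
lemma exists_decomposition_le_two_mul [IsTopologicalAddGroup E] [T2Space E]
    (h₀ : IsQuasiBanachIn 𝕜 κ N₀) (h₁ : IsQuasiBanachIn 𝕜 κ N₁) {t : ℝ} (ht : 0 < t) {f : E}
    (hf : KFunctional N₀ N₁ t f ≠ ∞) :
    ∃ f₀ f₁, f = f₀ + f₁ ∧ N₀ f₀ + ENNReal.ofReal t * N₁ f₁ ≤ 2 * KFunctional N₀ N₁ t f := by
  rcases eq_or_ne (KFunctional N₀ N₁ t f) 0 with h | h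
  · refine ⟨0, 0, ?_, ?_⟩
    · rw [add_zero, eq_zero_of_KFunctional_eq_zero h₀ h₁ ht h]
    · simp [h₀.map_zero, h₁.map_zero]
  · obtain ⟨f₀, f₁, hfe, hlt⟩ := exists_of_KFunctional_lt
      (c := 2 * KFunctional N₀ N₁ t f) (by rw [two_mul]; exact ENNReal.lt_add_right hf h)
    exact ⟨f₀, f₁, hfe, hlt.le⟩

end KFunctional

lemma nestedNorm_le_limLNorm {E : Type*} [AddCommGroup E] (N₀ N₁ : E → ℝ≥0∞) (θ : ℝ) (r : ℝ≥0∞)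
    (b : ℝ → ℝ) (q : ℝ≥0∞) (a : ℝ → ℝ) (f : E) :
    nestedNorm (-θ) r b q a (fun x => KFunctional N₀ N₁ x f) ≤ limLNorm N₀ N₁ θ r b q a f := by
  rw [limLNorm]
  split_ifs
  · exact le_rfl
  · exact le_top

lemma limLNorm_of_memSum {E : Type*} [AddCommGroup E] {N₀ N₁ : E → ℝ≥0∞} {θ : ℝ} {r : ℝ≥0∞}
    {b : ℝ → ℝ} {q : ℝ≥0∞} {a : ℝ → ℝ} {f : E} (hf : MemSum N₀ N₁ f) :
    limLNorm N₀ N₁ θ r b q a f = nestedNorm (-θ) r b q a (fun x => KFunctional N₀ N₁ x f) := by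
  rw [limLNorm, if_pos hf]
  rfl

lemma ofReal_rho {t : ℝ} (ht : 0 < t) (h₀ : chi0 r₀ b₀ q₀ a₀ t ≠ ∞)
    (h₁ : chi1 r₁ b₁ q₁ a₁ t ≠ ∞) (h₁' : chi1 r₁ b₁ q₁ a₁ t ≠ 0) :
    ENNReal.ofReal (rho r₀ b₀ q₀ a₀ r₁ b₁ q₁ a₁ t) =
      ENNReal.ofReal t * chi0 r₀ b₀ q₀ a₀ t * (chi1 r₁ b₁ q₁ a₁ t)⁻¹ := by
  rw [rho, ENNReal.ofReal_div_of_pos (ENNReal.toReal_pos h₁' h₁), ENNReal.ofReal_mul ht.le,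
    ENNReal.ofReal_toReal h₀, ENNReal.ofReal_toReal h₁, div_eq_mul_inv]

/-! ### The two inequalities -/

/-- The upper estimate of the `K`-functional: decompose `f` almost optimally for `K(t, f)`. -/
lemma exists_KFunctional_limLNorm_le (𝕜 : Type*) [RCLike 𝕜]
    (ha₀ : IsSlowlyVarying a₀) (hb₀ : IsSlowlyVarying b₀) (ha₁ : IsSlowlyVarying a₁)
    (hb₁ : IsSlowlyVarying b₁) (κ : ℝ≥0) :
    ∃ C : ℝ≥0, ∀ (E : Type u) [AddCommGroup E] [Module 𝕜 E] [TopologicalSpace E]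
      [IsTopologicalAddGroup E] [T2Space E] (N₀ N₁ : E → ℝ≥0∞),
      IsQuasiBanachIn 𝕜 κ N₀ → IsQuasiBanachIn 𝕜 κ N₁ → ∀ (f : E) (t ρ : ℝ), 0 < t →
      chi0 r₀ b₀ q₀ a₀ t ≠ 0 → chi1 r₁ b₁ q₁ a₁ t ≠ 0 → chi1 r₁ b₁ q₁ a₁ t ≠ ∞ →
      ENNReal.ofReal ρ = ENNReal.ofReal t * chi0 r₀ b₀ q₀ a₀ t * (chi1 r₁ b₁ q₁ a₁ t)⁻¹ →
      KFunctional (limLNorm N₀ N₁ 0 r₀ b₀ q₀ a₀) (limLNorm N₀ N₁ 1 r₁ b₁ q₁ a₁) ρ f ≤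
        C * holmstedtSum r₀ b₀ q₀ a₀ r₁ b₁ q₁ a₁ (ENNReal.ofReal ρ)
          (fun s => KFunctional N₀ N₁ s f) t := by
  -- Below, `K(·, f₀)` and `K(·, f₁)` are bounded with the factor `2` or `3 κ`, hence with the sum.
  obtain ⟨C₀, hC₀⟩ := exists_nestedNorm_zero_le (r := r₀) (q := q₀) ha₀ hb₀ (3 * κ + 2)
  obtain ⟨C₁, hC₁⟩ := exists_nestedNorm_neg_one_le (r := r₁) (q := q₁) ha₁ hb₁ (3 * κ + 2)
  refine ⟨C₀ + C₁ + 1, fun E _ _ _ _ _ N₀ N₁ h₀ h₁ f t ρ ht hχ₀ hχ₁ hχ₁' hρ => ?_⟩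
  set K : ℝ → ℝ≥0∞ := fun s => KFunctional N₀ N₁ s f with hK
  have hKqc : QuasiConcave K := quasiConcave_KFunctional N₀ N₁ f
  rcases eq_or_ne (K t) ∞ with htop | htop
  · have : holmstedtSum r₀ b₀ q₀ a₀ r₁ b₁ q₁ a₁ (ENNReal.ofReal ρ) K t = ∞ := by
      rw [holmstedtSum, htop, ENNReal.mul_top hχ₀, add_top]
    rw [this, ENNReal.mul_top (by norm_cast; positivity)]
    exact le_top
  obtain ⟨f₀, f₁, hfe, hle⟩ := exists_decomposition_le_two_mul h₀ h₁ ht htop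
  have hN₀ : N₀ f₀ ≤ 2 * K t := le_self_add.trans hle
  have hN₁ : ENNReal.ofReal t * N₁ f₁ ≤ 2 * K t := le_add_self.trans hle
  have ht' : ENNReal.ofReal t ≠ 0 := by simpa using ht
  have htt : ENNReal.ofReal t * ENNReal.ofReal t⁻¹ = 1 := by
    rw [← ENNReal.ofReal_mul ht.le, mul_inv_cancel₀ ht.ne', ENNReal.ofReal_one]
  have hN₁' : N₁ f₁ ≤ 2 * K t * ENNReal.ofReal t⁻¹ :=
    calc N₁ f₁ = ENNReal.ofReal t * N₁ f₁ * ENNReal.ofReal t⁻¹ := by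
          rw [mul_right_comm, htt, one_mul]
      _ ≤ _ := mul_le_mul_left hN₁ _
  have hK₀ : ∀ (u : ℝ), KFunctional N₀ N₁ u f₀ ≤ N₀ f₀ := fun u => by
    simpa [h₁.map_zero] using KFunctional_le N₀ N₁ u f₀ 0
  have hK₁ : ∀ (u : ℝ) (g : E), KFunctional N₀ N₁ u g ≤ ENNReal.ofReal u * N₁ g := fun u g => by
    simpa [h₀.map_zero] using KFunctional_le N₀ N₁ u 0 g
  have hm : (3 * κ : ℝ≥0∞) ≤ ((3 * κ + 2 : ℝ≥0) : ℝ≥0∞) := by push_cast; exact le_self_add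
  have hm' : (2 : ℝ≥0∞) ≤ ((3 * κ + 2 : ℝ≥0) : ℝ≥0∞) := by push_cast; exact le_add_self
  have mem₀ : MemSum N₀ N₁ f₀ :=
    ⟨f₀, 0, (add_zero _).symm, hN₀.trans_lt (by finiteness), by simp [h₁.map_zero]⟩
  have mem₁ : MemSum N₀ N₁ f₁ :=
    ⟨0, f₁, (zero_add _).symm, by simp [h₀.map_zero], hN₁'.trans_lt (by finiteness)⟩
  have e₀ := hC₀ K (fun u => KFunctional N₀ N₁ u f₀) t ht
    (quasiConcave_KFunctional N₀ N₁ f₀).mono.measurable htop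
    (fun u hu hut => by
      have hfe' : f₀ = f + -f₁ := by rw [hfe, add_neg_cancel_right]
      have huK : ENNReal.ofReal u * N₁ (-f₁) ≤ 2 * K u := by
        rw [h₁.map_neg]
        calc _ ≤ ENNReal.ofReal u * (2 * K t * ENNReal.ofReal t⁻¹) := mul_le_mul_right hN₁' _
          _ = 2 * (ENNReal.ofReal u * K t) * ENNReal.ofReal t⁻¹ := by ring
          _ ≤ 2 * (ENNReal.ofReal t * K u) * ENNReal.ofReal t⁻¹ :=
            mul_le_mul_left (mul_le_mul_right (hKqc.mul_le u t hu hut.le) _) _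
          _ = 2 * K u * (ENNReal.ofReal t * ENNReal.ofReal t⁻¹) := by ring
          _ = _ := by rw [htt, mul_one]
      calc KFunctional N₀ N₁ u f₀ = KFunctional N₀ N₁ u (f + -f₁) := by rw [← hfe']
        _ ≤ κ * (K u + KFunctional N₀ N₁ u (-f₁)) := KFunctional_add_le h₀.add_le h₁.add_le u _ _
        _ ≤ κ * (K u + 2 * K u) := by gcongr; exact (hK₁ u _).trans huK
        _ = 3 * κ * K u := by ring
        _ ≤ _ := mul_le_mul_left hm _)
    (fun u _ => ((hK₀ u).trans hN₀).trans (mul_le_mul_left hm' _))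
  have e₁ := hC₁ K (fun u => KFunctional N₀ N₁ u f₁) t ht
    (quasiConcave_KFunctional N₀ N₁ f₁).mono.measurable htop
    (fun u _ _ => by
      calc KFunctional N₀ N₁ u f₁ ≤ ENNReal.ofReal u * (2 * K t * ENNReal.ofReal t⁻¹) :=
            (hK₁ u f₁).trans (mul_le_mul_right hN₁' _)
        _ = 2 * K t * ENNReal.ofReal t⁻¹ * ENNReal.ofReal u := by ring
        _ ≤ _ := by gcongr)
    (fun u hut => by
      have hfe' : f₁ = f + -f₀ := by rw [hfe, add_comm f₀, add_neg_cancel_right]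
      have hneg : KFunctional N₀ N₁ u (-f₀) ≤ 2 * K u := by
        have := KFunctional_le N₀ N₁ u (-f₀) 0
        rw [add_zero, h₁.map_zero, mul_zero, add_zero, h₀.map_neg] at this
        exact (this.trans hN₀).trans (mul_le_mul_right (hKqc.mono hut.le) _)
      calc KFunctional N₀ N₁ u f₁ = KFunctional N₀ N₁ u (f + -f₀) := by rw [← hfe']
        _ ≤ κ * (K u + KFunctional N₀ N₁ u (-f₀)) := KFunctional_add_le h₀.add_le h₁.add_le u _ _
        _ ≤ κ * (K u + 2 * K u) := by gcongr
        _ = 3 * κ * K u := by ring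
        _ ≤ _ := mul_le_mul_left hm _)
  have hρχ : ENNReal.ofReal ρ * (ENNReal.ofReal t⁻¹ * chi1 r₁ b₁ q₁ a₁ t * K t) =
      chi0 r₀ b₀ q₀ a₀ t * K t := by
    rw [hρ]
    calc _ = (ENNReal.ofReal t * ENNReal.ofReal t⁻¹) *
          (chi1 r₁ b₁ q₁ a₁ t * (chi1 r₁ b₁ q₁ a₁ t)⁻¹) * (chi0 r₀ b₀ q₀ a₀ t * K t) := by ring
      _ = _ := by rw [htt, ENNReal.mul_inv_cancel hχ₁ hχ₁', one_mul, one_mul]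
  subst hfe
  refine (KFunctional_le _ _ ρ f₀ f₁).trans ?_
  rw [limLNorm_of_memSum mem₀, limLNorm_of_memSum mem₁, neg_zero]
  set A := wNorm 0 r₀ b₀ (Ioo 0 t) (fun s => wNorm 0 q₀ a₀ (Ioo 0 s) K)
  set B := wNorm 0 r₀ b₀ (Ioi t) (fun _ => 1) * wNorm 0 q₀ a₀ (Ioo 0 t) K
  set D := wNorm 0 r₁ b₁ (Ioi t) (fun s => wNorm (-1) q₁ a₁ (Ioo t s) K)
  set X := chi0 r₀ b₀ q₀ a₀ t * K t
  have hsum : holmstedtSum r₀ b₀ q₀ a₀ r₁ b₁ q₁ a₁ (ENNReal.ofReal ρ) K t =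
      A + B + ENNReal.ofReal ρ * D + X := rfl
  calc _ ≤ C₀ * (A + B + X) + ENNReal.ofReal ρ *
        (C₁ * (ENNReal.ofReal t⁻¹ * chi1 r₁ b₁ q₁ a₁ t * K t + D)) := by gcongr
    _ = C₀ * (A + B + X) + C₁ * (ENNReal.ofReal ρ *
        (ENNReal.ofReal t⁻¹ * chi1 r₁ b₁ q₁ a₁ t * K t) + ENNReal.ofReal ρ * D) := by ring
    _ = C₀ * (A + B + X) + C₁ * (X + ENNReal.ofReal ρ * D) := by rw [hρχ]
    _ ≤ C₀ * (A + B + ENNReal.ofReal ρ * D + X) + C₁ * (A + B + ENNReal.ofReal ρ * D + X) := by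
      refine add_le_add (mul_le_mul_right (add_le_add le_self_add le_rfl) _)
        (mul_le_mul_right ?_ _)
      rw [add_comm X]
      exact add_le_add le_add_self le_rfl
    _ ≤ _ := by
      rw [hsum]
      push_cast
      rw [add_mul, add_mul]
      exact le_self_add

/-- The lower estimate of the `K`-functional: the sum is quasi-subadditive in `f`, and it is bounded
on each of the two spaces. -/
lemma exists_holmstedtSum_le_KFunctional (hq₀ : 0 < q₀) (hr₀ : 0 < r₀) (hq₁ : 0 < q₁)
    (hr₁ : 0 < r₁) (ha₀ : IsSlowlyVarying a₀) (hb₀ : IsSlowlyVarying b₀)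
    (ha₁ : IsSlowlyVarying a₁) (hb₁ : IsSlowlyVarying b₁)
    (hχ₀ : ∀ t, 0 < t → chi0 r₀ b₀ q₀ a₀ t < ∞) (hχ₁ : ∀ t, 0 < t → chi1 r₁ b₁ q₁ a₁ t < ∞)
    (κ : ℝ≥0) :
    ∃ C : ℝ≥0, ∀ (E : Type u) [AddCommGroup E] (N₀ N₁ : E → ℝ≥0∞),
      (∀ x y, N₀ (x + y) ≤ κ * (N₀ x + N₀ y)) → (∀ x y, N₁ (x + y) ≤ κ * (N₁ x + N₁ y)) →
      ∀ (f : E) (t ρ : ℝ), 0 < t →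
      ENNReal.ofReal ρ = ENNReal.ofReal t * chi0 r₀ b₀ q₀ a₀ t * (chi1 r₁ b₁ q₁ a₁ t)⁻¹ →
      holmstedtSum r₀ b₀ q₀ a₀ r₁ b₁ q₁ a₁ (ENNReal.ofReal ρ)
          (fun s => KFunctional N₀ N₁ s f) t ≤
        C * KFunctional (limLNorm N₀ N₁ 0 r₀ b₀ q₀ a₀) (limLNorm N₀ N₁ 1 r₁ b₁ q₁ a₁) ρ f := by
  obtain ⟨C, hC⟩ := exists_holmstedtSum_le_add (r₀ := r₀) (q₀ := q₀) (r₁ := r₁) (q₁ := q₁)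
    ha₀ hb₀ ha₁ hb₁ κ
  obtain ⟨C₀, hC₀⟩ := exists_holmstedtSum_le_left (r₁ := r₁) hq₀ hr₀ hq₁ ha₀ hb₀ ha₁ hχ₀ (b₁ := b₁)
  obtain ⟨C₁, hC₁⟩ := exists_holmstedtSum_le_right hq₀ hr₀ hq₁ hr₁ ha₀ hb₀ ha₁ hb₁ hχ₁
  set M : ℝ≥0 := C * (C₀ + C₁) + 1 with hM
  have hM0 : (M : ℝ≥0∞) ≠ 0 := by rw [hM]; norm_cast; positivity
  refine ⟨M, fun E _ N₀ N₁ h₀ h₁ f t ρ ht hρ => ?_⟩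
  rw [mul_comm, ← ENNReal.div_le_iff hM0 ENNReal.coe_ne_top]
  refine le_KFunctional fun g₀ g₁ hg => ?_
  rw [ENNReal.div_le_iff hM0 ENNReal.coe_ne_top]
  subst hg
  have qc := fun g : E => quasiConcave_KFunctional N₀ N₁ g
  have e₀ := hC₀ _ t (qc g₀) ht
  have e₁ := hC₁ _ t (qc g₁) ht
  rw [← hρ] at e₀ e₁
  have n₀ := nestedNorm_le_limLNorm N₀ N₁ 0 r₀ b₀ q₀ a₀ g₀
  have n₁ := nestedNorm_le_limLNorm N₀ N₁ 1 r₁ b₁ q₁ a₁ g₁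
  rw [neg_zero] at n₀
  set X := limLNorm N₀ N₁ 0 r₀ b₀ q₀ a₀ g₀
  set Y := limLNorm N₀ N₁ 1 r₁ b₁ q₁ a₁ g₁
  calc _ ≤ _ := hC (ENNReal.ofReal ρ) _ _ _ t ht (qc g₀).mono (qc g₁).mono
        fun x _ => KFunctional_add_le h₀ h₁ x g₀ g₁
    _ ≤ C * (C₀ * X + C₁ * (ENNReal.ofReal ρ * Y)) :=
      mul_le_mul_right (add_le_add (e₀.trans (mul_le_mul_right n₀ _))
        (e₁.trans (mul_le_mul_right (mul_le_mul_right n₁ _) _))) _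
    _ ≤ C * ((C₀ + C₁) * (X + ENNReal.ofReal ρ * Y)) := by
      refine mul_le_mul_right ?_ _
      rw [add_mul]
      exact add_le_add (mul_le_mul_right le_self_add _) (mul_le_mul_right le_add_self _)
    _ ≤ _ := by
      rw [hM, ← mul_assoc, mul_comm (X + _)]
      push_cast
      exact mul_le_mul_left le_self_add _

end LimitingInterpolation

end

theorem theorem30 (𝕜 : Type*) [RCLike 𝕜]
    (q₀ r₀ q₁ r₁ : ℝ≥0∞) (hq₀ : 0 < q₀) (hr₀ : 0 < r₀) (hq₁ : 0 < q₁) (hr₁ : 0 < r₁)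
    (a₀ b₀ a₁ b₁ : ℝ → ℝ)
    (ha₀ : LimitingInterpolation.IsSlowlyVarying a₀)
    (hb₀ : LimitingInterpolation.IsSlowlyVarying b₀)
    (ha₁ : LimitingInterpolation.IsSlowlyVarying a₁)
    (hb₁ : LimitingInterpolation.IsSlowlyVarying b₁)
    (h₀ : LimitingInterpolation.wNorm 0 r₀ b₀ (Ioi 1)
      (fun s => LimitingInterpolation.wNorm 0 q₀ a₀ (Ioo 1 s) fun _ => 1) < ∞)
    (h₁ : LimitingInterpolation.wNorm 0 r₁ b₁ (Ioi 1) (fun _ => 1) < ∞)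
    (h₁' : LimitingInterpolation.wNorm 0 r₁ b₁ (Ioo 0 1)
      (fun s => LimitingInterpolation.wNorm 0 q₁ a₁ (Ioo 0 s) fun _ => 1) < ∞)
    (κ : ℝ≥0) :
    (∀ t : ℝ, 0 < t →
      (0 < LimitingInterpolation.chi0 r₀ b₀ q₀ a₀ t ∧
        LimitingInterpolation.chi0 r₀ b₀ q₀ a₀ t < ∞) ∧
      (0 < LimitingInterpolation.chi1 r₁ b₁ q₁ a₁ t ∧
        LimitingInterpolation.chi1 r₁ b₁ q₁ a₁ t < ∞)) ∧
    ∃ C : ℝ≥0, ∀ (E : Type u) [AddCommGroup E] [Module 𝕜 E] [TopologicalSpace E]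
      [IsTopologicalAddGroup E] [ContinuousSMul 𝕜 E] [T2Space E] (N₀ N₁ : E → ℝ≥0∞),
      LimitingInterpolation.IsQuasiBanachIn 𝕜 κ N₀ →
      LimitingInterpolation.IsQuasiBanachIn 𝕜 κ N₁ →
      (∃ x : E, x ≠ 0 ∧ N₀ x < ∞ ∧ N₁ x < ∞) →
      ∀ X₀ X₁ : E → ℝ≥0∞,
      X₀ = LimitingInterpolation.limLNorm N₀ N₁ 0 r₀ b₀ q₀ a₀ →
      X₁ = LimitingInterpolation.limLNorm N₀ N₁ 1 r₁ b₁ q₁ a₁ →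
      ∀ f : E, LimitingInterpolation.MemSum X₀ X₁ f →
      ∀ t : ℝ, 0 < t →
      ∀ (K : ℝ → ℝ≥0∞) (ρ : ℝ) (R : ℝ≥0∞),
      K = (fun s => LimitingInterpolation.KFunctional N₀ N₁ s f) →
      ρ = LimitingInterpolation.rho r₀ b₀ q₀ a₀ r₁ b₁ q₁ a₁ t →
      R =
        LimitingInterpolation.wNorm 0 r₀ b₀ (Ioo 0 t)
            (fun s => LimitingInterpolation.wNorm 0 q₀ a₀ (Ioo 0 s) K)
          + LimitingInterpolation.wNorm 0 r₀ b₀ (Ioi t) (fun _ => 1)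
            * LimitingInterpolation.wNorm 0 q₀ a₀ (Ioo 0 t) K
          + ENNReal.ofReal ρ * LimitingInterpolation.wNorm 0 r₁ b₁ (Ioi t)
            (fun s => LimitingInterpolation.wNorm (-1) q₁ a₁ (Ioo t s) K)
          + LimitingInterpolation.chi0 r₀ b₀ q₀ a₀ t * K t →
      LimitingInterpolation.KFunctional X₀ X₁ ρ f ≤ C * R ∧
        R ≤ C * LimitingInterpolation.KFunctional X₀ X₁ ρ f := by
  have hχ₀ : ∀ t : ℝ, 0 < t → LimitingInterpolation.chi0 r₀ b₀ q₀ a₀ t < ∞ := fun t ht =>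
    LimitingInterpolation.chi0_lt_top ha₀ hb₀ h₀ ht
  have hχ₁ : ∀ t : ℝ, 0 < t → LimitingInterpolation.chi1 r₁ b₁ q₁ a₁ t < ∞ := fun t ht =>
    LimitingInterpolation.chi1_lt_top hr₁ ha₁ hb₁ h₁ h₁' ht
  have hχ₀' : ∀ t : ℝ, 0 < t → 0 < LimitingInterpolation.chi0 r₀ b₀ q₀ a₀ t := fun t ht =>
    LimitingInterpolation.chi0_pos hq₀ hr₀ ha₀ hb₀ ht
  have hχ₁' : ∀ t : ℝ, 0 < t → 0 < LimitingInterpolation.chi1 r₁ b₁ q₁ a₁ t := fun t ht =>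
    LimitingInterpolation.chi1_pos hq₁ hr₁ ha₁ hb₁ ht
  refine ⟨fun t ht => ⟨⟨hχ₀' t ht, hχ₀ t ht⟩, hχ₁' t ht, hχ₁ t ht⟩, ?_⟩
  obtain ⟨C, hC⟩ := LimitingInterpolation.exists_KFunctional_limLNorm_le.{u} (r₀ := r₀) (q₀ := q₀)
    (r₁ := r₁) (q₁ := q₁) 𝕜 ha₀ hb₀ ha₁ hb₁ κ
  obtain ⟨D, hD⟩ := LimitingInterpolation.exists_holmstedtSum_le_KFunctional.{u} hq₀ hr₀ hq₁ hr₁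
    ha₀ hb₀ ha₁ hb₁ hχ₀ hχ₁ κ
  refine ⟨C + D, ?_⟩
  rintro E _ _ _ _ _ _ N₀ N₁ hN₀ hN₁ - X₀ X₁ rfl rfl f - t ht K ρ R rfl rfl rfl
  have hρ := LimitingInterpolation.ofReal_rho ht (hχ₀ t ht).ne (hχ₁ t ht).ne (hχ₁' t ht).ne'
  refine ⟨(hC E N₀ N₁ hN₀ hN₁ f t _ ht (hχ₀' t ht).ne' (hχ₁' t ht).ne' (hχ₁ t ht).ne hρ).trans ?_,
    (hD E N₀ N₁ hN₀.add_le hN₁.add_le f t _ ht hρ).trans ?_⟩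
  · exact mul_le_mul_left (by push_cast; exact le_self_add) _
  · exact mul_le_mul_left (by push_cast; exact le_add_self) _
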